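/- Let $T=[v_1,v_2,v_3]\subset\mathbb R^2$ be a nondegenerate triangle, and let $v_4,v_5,v_6$ be the midpoints of $[v_1,v_2]$, $[v_2,v_3]$, $[v_1,v_3]$. Let $T_{12}$ be the Powell-Sabin 12-split of $T$ (all lines joining two of the points $v_1,\dots,v_6$ are drawn inside $T$; twelve triangular faces), and let $\mathcal S^3_5$ be the space of $C^3$ functions on $T$ that are polynomials of total degree at most $5$ on each face. For a multiset $K$ of vertices of $T_{12}$ let $[K]$ be its convex hull and $Q[K]:\mathbb R^2\to\mathbb R$ the area normalized simplex spline: $Q[K]=0$ if $\operatorname{area}[K]=0$; $Q[K]=\mathbf 1_{[K)}\operatorname{area}(T)/\operatorname{area}([K])$ if $\operatorname{area}[K]\ne 0$ and $|K|=3$; and $Q[K](x)=\sum_j\beta_jQ[K\setminus v_j](x)$ if $\operatorname{area}[K]\neq0$ and $|K|>3$, where $x=\sum_j\beta_jv_j$, $\sum_j\beta_j=1$, and $\beta_j=0$ whenever $v_j\notin K$. Here every point of $T$ is assigned to one of the closed faces that contain it (in an arbitrary fixed way), and $[K)$ is the set of the points of $T$ whose assigned face lies in $[K]$. Write $Q_{ijklmn}=Q[v_1^iv_2^jv_3^kv_4^lv_5^mv_6^n]$.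 Functions on $T$ are identified with their extensions by zero to $\mathbb R^2$. Let $\Lambda$ consist of the following 39 functionals, where $\varepsilon_p$ is evaluation at $p$ and $D_w$ the derivative in direction $w$: for each corner $v$ with opposite edge $[v_i,v_j]$, all $\varepsilon_vD_x^aD_y^b$ with $a+b\le3$, $x=v_i-v$, $y=v_j-v$; and for each edge $e=[v_i,v_j]$ with midpoint $m_e$, quarterpoints $q_{1,e}=(3v_i+v_j)/4$ and $q_{2,e}=(v_i+3v_j)/4$, opposite corner $v_k$ and $u=v_k-m_e$, the functionals $\varepsilon_{q_{1,e}}D_u^2$, $\varepsilon_{m_e}D_u$, $\varepsilon_{q_{2,e}}D_u^2$. Then $\mathcal S^3_5$ has a basis $\{\lambda^*\}_{\lambda\in\Lambda}$ dual to $\Lambda$, that is, $\mu(\lambda^*)=1$ if $\mu=\lambda$ and $\mu(\lambda^*)=0$ otherwise. With $v=v_1$, $x=v_2-v_1$, $y=v_3-v_1$, $e=[v_1,v_2]$, $q_{1,e}=(3v_1+v_2)/4$ and $u=v_3-v_4$, \begin{align*} \varepsilon_v^*={}&\tfrac14Q_{600101}+\tfrac14(Q_{500201}+Q_{500102})+\tfrac12(Q_{410201}+Q_{401102})+Q_{411101}+\tfrac12(Q_{311201}+Q_{311102})\\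 &+\tfrac12(Q_{320201}+Q_{302102})+\tfrac9{16}(Q_{211211}+Q_{211112})+\tfrac38(Q_{220211}+Q_{202112})+\tfrac3{16}(Q_{112112}+Q_{121211}),\\ (\varepsilon_vD_x)^*={}&\tfrac1{40}Q_{500201}+\tfrac1{10}Q_{410201}+\tfrac15Q_{320201}+\tfrac1{10}Q_{411101}+\tfrac3{20}Q_{311201}+\tfrac{13}{80}Q_{220211}\\ &+\tfrac1{20}Q_{311102}+\tfrac{19}{80}Q_{211211}+\tfrac1{10}Q_{121211}-\tfrac1{40}Q_{211112}-\tfrac1{40}Q_{202112}-\tfrac1{20}Q_{112112},\\ (\varepsilon_vD_x^2)^*={}&\tfrac1{160}Q_{410201}+\tfrac1{32}Q_{320201}+\tfrac1{80}Q_{311201}+\tfrac{17}{640}Q_{220211}+\tfrac{121}{3840}Q_{211211}+\tfrac{71}{3840}Q_{121211}-\tfrac1{48}Q_{211112}+\tfrac1{480}Q_{112112},\\ (\varepsilon_vD_xD_y)^*={}&\tfrac1{80}Q_{411101}+\tfrac3{160}(Q_{311201}+Q_{311102})-\tfrac1{160}(Q_{220211}+Q_{202112})+\tfrac{17}{960}(Q_{211112}+Q_{211211})-\tfrac7{480}(Q_{112112}+Q_{121211}),\\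 (\varepsilon_vD_x^3)^*={}&\tfrac1{480}Q_{320201}+\tfrac7{3840}Q_{220211}+\tfrac5{3072}Q_{211211}+\tfrac7{5120}Q_{121211},\\ (\varepsilon_vD_x^2D_y)^*={}&\tfrac1{480}Q_{311201}-\tfrac1{1920}Q_{220211}-\tfrac1{768}Q_{121211}+\tfrac{11}{3840}Q_{211211}-\tfrac{11}{3840}Q_{211112}+\tfrac1{3840}Q_{112112},\\ (\varepsilon_{q_{1,e}}D_u^2)^*={}&\tfrac7{240}Q_{211211}-\tfrac1{240}Q_{121211},\\ (\varepsilon_{m_e}D_u)^*={}&\tfrac1{10}Q_{220211}+\tfrac15(Q_{211211}+Q_{121211}). \end{align*} The same eight formulas hold for every relabelling $v_{\sigma(1)},v_{\sigma(2)},v_{\sigma(3)}$ of the corners, $\sigma\in S_3$ (with $v_4,v_5,v_6$, the directions and the simplex splines relabelled accordingly); this gives all 39 nodal functions. In particular the coefficients are rational and do not depend on the triangle. -/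

import Mathlib

namespace PowellSabin

/-- The Euclidean plane. -/
abbrev Plane := EuclideanSpace ℝ (Fin 2)

/-- The area of a planar set (Lebesgue measure). -/
noncomputable def area (s : Set Plane) : ℝ := (MeasureTheory.volume s).toReal

/-- Barycentric coordinates, with respect to the macrotriangle, of the ten vertices
`v₁, …, v₁₀` of the 12-split (indices shifted by one): the three corners, the midpoints `v₄`, `v₅`,
`v₆` of `[v₁, v₂]`, `[v₂, v₃]`, `[v₁, v₃]`, the points `v₇`, `v₈`, `v₉` in which the medians from
`v₁`, `v₂`, `v₃` meet the sides of the triangle `[v₄, v₅, v₆]`, and the centroid `v₁₀`. -/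
def splitCoord : Fin 10 → Fin 3 → ℚ :=
  ![![1, 0, 0], ![0, 1, 0], ![0, 0, 1],
    ![1 / 2, 1 / 2, 0], ![0, 1 / 2, 1 / 2], ![1 / 2, 0, 1 / 2],
    ![1 / 2, 1 / 4, 1 / 4], ![1 / 4, 1 / 2, 1 / 4], ![1 / 4, 1 / 4, 1 / 2],
    ![1 / 3, 1 / 3, 1 / 3]]

/-- The vertices `v₁, …, v₁₀` of the 12-split of the triangle with corners `v 0`, `v 1`, `v 2`. -/
noncomputable def splitPoint (v : Fin 3 → Plane) (j : Fin 10) : Plane :=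
  ∑ k, (splitCoord j k : ℝ) • v k

/-- The closed macrotriangle. -/
def macroTriangle (v : Fin 3 → Plane) : Set Plane := convexHull ℝ (Set.range v)

/-- The vertices of the twelve faces of the 12-split. -/
def faceVertex : Fin 12 → Fin 3 → Fin 10 :=
  ![![0, 3, 6], ![0, 5, 6], ![1, 3, 7], ![1, 4, 7], ![2, 4, 8], ![2, 5, 8],
    ![3, 6, 9], ![3, 7, 9], ![4, 7, 9], ![4, 8, 9], ![5, 8, 9], ![5, 6, 9]]

/-- The twelve closed faces of the 12-split. -/
def face (v : Fin 3 → Plane) (f : Fin 12) : Set Plane :=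
  convexHull ℝ (Set.range fun k => splitPoint v (faceVertex f k))

/-- `cell` assigns every point of the macrotriangle to one of the closed faces of the 12-split
that contain it; the points assigned to a face make up the corresponding half-open face. -/
def IsFaceAssignment (v : Fin 3 → Plane) (cell : Plane → Set Plane) : Prop :=
  ∀ x ∈ macroTriangle v, x ∈ cell x ∧ ∃ f, cell x = face v f

/-- A point with nonnegative coordinates with respect to the vertices of a face lies in it. -/
theorem mem_face_of_coord (v : Fin 3 → Plane) (f : Fin 12) (w c : Fin 3 → ℝ) (hc : ∀ k, 0 ≤ c k)
    (h1 : ∑ k, c k = 1) (h : ∀ i, ∑ k, c k * (splitCoord (faceVertex f k) i : ℝ) = w i) :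
    ∑ i, w i • v i ∈ face v f := by
  have e : ∑ i, w i • v i = ∑ k, c k • splitPoint v (faceVertex f k) := by
    simp only [splitPoint, Finset.smul_sum, smul_smul]
    rw [Finset.sum_comm]
    refine Finset.sum_congr rfl fun i _ => ?_
    rw [← Finset.sum_smul, h i]
  rw [e]
  exact (convex_convexHull ℝ _).sum_mem (fun k _ => hc k) h1
    fun k _ => subset_convexHull ℝ _ ⟨k, rfl⟩

/-- The twelve faces cover the macrotriangle, so face assignments exist. -/
theorem exists_isFaceAssignment (v : Fin 3 → Plane) : ∃ cell, IsFaceAssignment v cell := by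
  have cover : ∀ x ∈ macroTriangle v, ∃ f, x ∈ face v f := by
    intro x hx
    obtain ⟨w, hw, hw1, rfl⟩ : ∃ w : Fin 3 → ℝ, (∀ i, 0 ≤ w i) ∧ ∑ i, w i = 1 ∧
        ∑ i, w i • v i = x := by
      rw [macroTriangle, convexHull_range_eq_exists_affineCombination] at hx
      obtain ⟨s, w, h0, h1, rfl⟩ := hx
      refine ⟨fun i => if i ∈ s then w i else 0, fun i => ?_, ?_, ?_⟩
      · dsimp only
        split_ifs with h
        exacts [h0 i h, le_rfl]
      · simpa using h1
      · rw [Finset.affineCombination_eq_linear_combination _ _ _ h1]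
        simp
    have h0 := hw 0
    have h1 := hw 1
    have h2 := hw 2
    rw [Fin.sum_univ_three] at hw1
    have go : ∀ (f : Fin 12) (a b c : ℝ), 0 ≤ a → 0 ≤ b → 0 ≤ c → a + b + c = 1 →
        (∀ i, a * (splitCoord (faceVertex f 0) i : ℝ) + b * (splitCoord (faceVertex f 1) i : ℝ) +
          c * (splitCoord (faceVertex f 2) i : ℝ) = w i) → ∃ f, ∑ i, w i • v i ∈ face v f := by
      intro f a b c ha hb hc hs h
      refine ⟨f, mem_face_of_coord v f w ![a, b, c] ?_ ?_ fun i => ?_⟩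
      · intro k
        fin_cases k <;> assumption
      · simpa [Fin.sum_univ_three] using hs
      · simpa [Fin.sum_univ_three] using h i
    have outer : ∀ (f : Fin 12) (i j k : Fin 3), w k ≤ w j → w j + w k ≤ w i →
        w i + w j + w k = 1 →
        (∀ l, (w i - w j - w k) * (splitCoord (faceVertex f 0) l : ℝ) +
          2 * (w j - w k) * (splitCoord (faceVertex f 1) l : ℝ) +
          4 * w k * (splitCoord (faceVertex f 2) l : ℝ) = w l) →
        ∃ f, ∑ i, w i • v i ∈ face v f := fun f i j k h h' hs =>
      go f _ _ _ (by linarith) (by linarith) (by linarith [hw k]) (by linarith)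
    have inner : ∀ (f : Fin 12) (i j k : Fin 3), w k ≤ w j → w j ≤ w i → w i ≤ w j + w k →
        w i + w j + w k = 1 →
        (∀ l, 2 * (w j - w k) * (splitCoord (faceVertex f 0) l : ℝ) +
          4 * (w i - w j) * (splitCoord (faceVertex f 1) l : ℝ) +
          3 * (w j + w k - w i) * (splitCoord (faceVertex f 2) l : ℝ) = w l) →
        ∃ f, ∑ i, w i • v i ∈ face v f := fun f i j k h h' h'' hs =>
      go f _ _ _ (by linarith) (by linarith) (by linarith) (by linarith)
    have split : ∀ (f g : Fin 12) (i j k : Fin 3), w k ≤ w j → w j ≤ w i → w i + w j + w k = 1 →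
        (∀ l, (w i - w j - w k) * (splitCoord (faceVertex f 0) l : ℝ) +
          2 * (w j - w k) * (splitCoord (faceVertex f 1) l : ℝ) +
          4 * w k * (splitCoord (faceVertex f 2) l : ℝ) = w l) →
        (∀ l, 2 * (w j - w k) * (splitCoord (faceVertex g 0) l : ℝ) +
          4 * (w i - w j) * (splitCoord (faceVertex g 1) l : ℝ) +
          3 * (w j + w k - w i) * (splitCoord (faceVertex g 2) l : ℝ) = w l) →
        ∃ f, ∑ i, w i • v i ∈ face v f := by
      intro f g i j k h h' hs hf hg
      rcases le_total (w j + w k) (w i) with h'' | h''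
      · exact outer f i j k h h'' hs hf
      · exact inner g i j k h h' h'' hs hg
    rcases le_total (w 0) (w 1) with h01 | h01 <;> rcases le_total (w 1) (w 2) with h12 | h12 <;>
      rcases le_total (w 0) (w 2) with h02 | h02
    · refine split 4 9 2 1 0 (by linarith) (by linarith) (by linarith) ?_ ?_ <;>
        simp [Fin.forall_fin_succ, faceVertex, splitCoord] <;> ring_nf <;> simp
    · refine split 4 9 2 1 0 (by linarith) (by linarith) (by linarith) ?_ ?_ <;>
        simp [Fin.forall_fin_succ, faceVertex, splitCoord] <;> ring_nf <;> simp
    · refine split 3 8 1 2 0 (by linarith) (by linarith) (by linarith) ?_ ?_ <;>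
        simp [Fin.forall_fin_succ, faceVertex, splitCoord] <;> ring_nf <;> simp
    · refine split 2 7 1 0 2 (by linarith) (by linarith) (by linarith) ?_ ?_ <;>
        simp [Fin.forall_fin_succ, faceVertex, splitCoord] <;> ring_nf <;> simp
    · refine split 5 10 2 0 1 (by linarith) (by linarith) (by linarith) ?_ ?_ <;>
        simp [Fin.forall_fin_succ, faceVertex, splitCoord] <;> ring_nf <;> simp
    · refine split 1 11 0 2 1 (by linarith) (by linarith) (by linarith) ?_ ?_ <;>
        simp [Fin.forall_fin_succ, faceVertex, splitCoord] <;> ring_nf <;> simp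
    · refine split 0 6 0 1 2 (by linarith) (by linarith) (by linarith) ?_ ?_ <;>
        simp [Fin.forall_fin_succ, faceVertex, splitCoord] <;> ring_nf <;> simp
    · refine split 0 6 0 1 2 (by linarith) (by linarith) (by linarith) ?_ ?_ <;>
        simp [Fin.forall_fin_succ, faceVertex, splitCoord] <;> ring_nf <;> simp
  choose! f hf using cover
  exact ⟨fun x => face v (f x), fun x hx => ⟨hf x hx, f x, rfl⟩⟩

/-! ### Knot multisets and simplex splines

A knot multiset `{v₁^{m₁} ⋯ v₁₀^{m₁₀}}` is given by its multiplicities `m : Fin 10 → ℕ`. -/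

/-- The convex hull of the knots. -/
def knotHull (v : Fin 3 → Plane) (m : Fin 10 → ℕ) : Set Plane :=
  convexHull ℝ (splitPoint v '' {j | m j ≠ 0})

/-- The half-open convex hull of the knots: the union of the half-open faces whose closed face
lies in the convex hull. -/
def halfOpenHull (v : Fin 3 → Plane) (cell : Plane → Set Plane) (m : Fin 10 → ℕ) : Set Plane :=
  {x | x ∈ macroTriangle v ∧ cell x ⊆ knotHull v m}

/-- Twice the signed area of the triangle `[a, b, c]`. -/
def orient (a b c : Plane) : ℝ :=
  (b 0 - a 0) * (c 1 - a 1) - (c 0 - a 0) * (b 1 - a 1)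

/-- All triples of indices of vertices of the 12-split, in lexicographic order. -/
def triples : List (Fin 10 × Fin 10 × Fin 10) :=
  List.product (List.finRange 10) (List.product (List.finRange 10) (List.finRange 10))

open Classical in
/-- The first triple of affinely independent knots, if there is one. -/
noncomputable def knotTriple (v : Fin 3 → Plane) (m : Fin 10 → ℕ) :
    Option (Fin 10 × Fin 10 × Fin 10) :=
  triples.find? fun t => decide ((m t.1 ≠ 0 ∧ m t.2.1 ≠ 0 ∧ m t.2.2 ≠ 0) ∧
    orient (splitPoint v t.1) (splitPoint v t.2.1) (splitPoint v t.2.2) ≠ 0)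

/-- Coefficients `β₁, …, β₁₀` with `x = ∑ βⱼ vⱼ`, `∑ βⱼ = 1`, and `βⱼ = 0` whenever `mⱼ = 0`: the
barycentric coordinates of `x` with respect to the first triple of affinely independent knots
(see `knotCoord_spec`). The simplex spline does not depend on which such coefficients are used. -/
noncomputable def knotCoord (v : Fin 3 → Plane) (m : Fin 10 → ℕ) (x : Plane) : Fin 10 → ℝ :=
  match knotTriple v m with
  | none => 0
  | some (a, b, c) =>
    let A := splitPoint v a
    let B := splitPoint v b
    let C := splitPoint v c
    Pi.single a (orient x B C / orient A B C) + Pi.single b (orient A x C / orient A B C) +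
      Pi.single c (orient A B x / orient A B C)

/-- The coefficients `knotCoord v m x` are admissible in the recursion for simplex splines. -/
theorem knotCoord_spec (v : Fin 3 → Plane) (m : Fin 10 → ℕ) (x : Plane)
    (h : area (knotHull v m) ≠ 0) :
    ∑ j, knotCoord v m x j = 1 ∧ ∑ j, knotCoord v m x j • splitPoint v j = x ∧
      ∀ j, m j = 0 → knotCoord v m x j = 0 := by
  classical
  have hex : ∃ t ∈ triples, (m t.1 ≠ 0 ∧ m t.2.1 ≠ 0 ∧ m t.2.2 ≠ 0) ∧
      orient (splitPoint v t.1) (splitPoint v t.2.1) (splitPoint v t.2.2) ≠ 0 := by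
    by_contra hno
    apply h
    have key : ∀ a b c, m a ≠ 0 → m b ≠ 0 → m c ≠ 0 →
        orient (splitPoint v a) (splitPoint v b) (splitPoint v c) = 0 := by
      intro a b c ha hb hc
      by_contra hne
      exact hno ⟨(a, b, c), by simp [triples], ⟨ha, hb, hc⟩, hne⟩
    have main : ∀ (p w : Plane), w ≠ 0 →
        (∀ c, m c ≠ 0 → w 0 * (splitPoint v c 1 - p 1) - (splitPoint v c 0 - p 0) * w 1 = 0) →
        area (knotHull v m) = 0 := by
      intro p w hw hc
      let φ : Plane →ₗ[ℝ] ℝ :=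
        w 0 • (EuclideanSpace.proj (1 : Fin 2) : Plane →L[ℝ] ℝ).toLinearMap -
          w 1 • (EuclideanSpace.proj (0 : Fin 2) : Plane →L[ℝ] ℝ).toLinearMap
      have hφ : ∀ z : Plane, φ z = w 0 * z 1 - w 1 * z 0 := fun z => by simp [φ]
      let L : AffineSubspace ℝ Plane := AffineSubspace.mk' p (LinearMap.ker φ)
      have hL : knotHull v m ⊆ (L : Set Plane) := by
        refine convexHull_min ?_ L.convex
        rintro _ ⟨c, hcm, rfl⟩
        simp only [L, SetLike.mem_coe, AffineSubspace.mem_mk', LinearMap.mem_ker, hφ, vsub_eq_sub,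
          PiLp.sub_apply]
        linarith [hc c hcm]
      have hLt : L ≠ ⊤ := by
        intro ht
        have hd : L.direction = ⊤ := by rw [ht, AffineSubspace.direction_top]
        rw [AffineSubspace.direction_mk'] at hd
        have hz : ∀ z, φ z = 0 := fun z => by
          have : z ∈ LinearMap.ker φ := hd ▸ Submodule.mem_top
          exact this
        apply hw
        have h0 := hz (EuclideanSpace.single 1 1)
        have h1 := hz (EuclideanSpace.single 0 1)
        rw [hφ] at h0 h1
        simp at h0 h1
        ext i
        fin_cases i
        · simpa using h0
        · simpa using h1
      have h0 := MeasureTheory.Measure.addHaar_affineSubspace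
        (MeasureTheory.volume : MeasureTheory.Measure Plane) L hLt
      simp [area, MeasureTheory.measure_mono_null hL h0]
    by_cases hab : ∃ a b, m a ≠ 0 ∧ m b ≠ 0 ∧ splitPoint v b - splitPoint v a ≠ 0
    · obtain ⟨a, b, ha, hb, hne⟩ := hab
      refine main (splitPoint v a) _ hne fun c hc => ?_
      have := key a b c ha hb hc
      simpa [orient] using this
    · push Not at hab
      have hw : (EuclideanSpace.single 0 1 : Plane) ≠ 0 := by simp
      by_cases ha : ∃ a, m a ≠ 0
      · obtain ⟨a, ha⟩ := ha
        refine main (splitPoint v a) _ hw fun c hc => ?_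
        have := sub_eq_zero.1 (hab a c ha hc)
        simp [this]
      · push Not at ha
        exact main 0 _ hw fun c hc => absurd (ha c) hc
  obtain ⟨⟨a, b, c⟩, ht⟩ : ∃ t, knotTriple v m = some t := by
    rw [← Option.isSome_iff_exists, knotTriple, List.find?_isSome]
    obtain ⟨t, ht, h'⟩ := hex
    exact ⟨t, ht, by simpa using h'⟩
  have hs := List.find?_some ht
  simp only [decide_eq_true_eq] at hs
  obtain ⟨⟨ha, hb, hc⟩, hne⟩ := hs
  have e : knotCoord v m x =
      Pi.single a (orient x (splitPoint v b) (splitPoint v c) /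
        orient (splitPoint v a) (splitPoint v b) (splitPoint v c)) +
      Pi.single b (orient (splitPoint v a) x (splitPoint v c) /
        orient (splitPoint v a) (splitPoint v b) (splitPoint v c)) +
      Pi.single c (orient (splitPoint v a) (splitPoint v b) x /
        orient (splitPoint v a) (splitPoint v b) (splitPoint v c)) := by
    simp only [knotCoord, ht]
  rw [e]
  refine ⟨?_, ?_, ?_⟩
  · simp only [Pi.add_apply, Finset.sum_add_distrib, Finset.sum_pi_single', Finset.mem_univ, if_true]
    field_simp
    simp only [orient]
    ring
  · simp only [Pi.add_apply, add_smul, Finset.sum_add_distrib, Pi.single_apply, ite_smul, zero_smul,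
      Finset.sum_ite_eq', Finset.mem_univ, if_true]
    ext i
    simp only [PiLp.add_apply, PiLp.smul_apply, smul_eq_mul]
    field_simp
    fin_cases i <;> simp only [orient, Fin.mk_one, Fin.zero_eta] <;> ring
  · intro j hj
    have h1 : j ≠ a := fun h => ha (h ▸ hj)
    have h2 : j ≠ b := fun h => hb (h ▸ hj)
    have h3 : j ≠ c := fun h => hc (h ▸ hj)
    simp [h1, h2, h3]

/-- Removing one copy of the knot `vⱼ`. -/
def removeKnot (m : Fin 10 → ℕ) (j : Fin 10) : Fin 10 → ℕ := Function.update m j (m j - 1)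

open Classical in
/-- The recursion for simplex splines; the first argument is the number of knots minus three. -/
noncomputable def simplexSplineAux (v : Fin 3 → Plane) (cell : Plane → Set Plane) :
    ℕ → (Fin 10 → ℕ) → Plane → ℝ
  | 0, m, x =>
    if area (knotHull v m) = 0 then 0
    else (halfOpenHull v cell m).indicator 1 x * (area (macroTriangle v) / area (knotHull v m))
  | n + 1, m, x =>
    if area (knotHull v m) = 0 then 0
    else ∑ j, knotCoord v m x j * simplexSplineAux v cell n (removeKnot m j) x

/-- The area normalized simplex spline `Q[v₁^{m₁} ⋯ v₁₀^{m₁₀}]`. -/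
noncomputable def simplexSpline (v : Fin 3 → Plane) (cell : Plane → Set Plane) (m : Fin 10 → ℕ) :
    Plane → ℝ :=
  simplexSplineAux v cell ((∑ j, m j) - 3) m

/-- Degenerate knot multisets have simplex spline zero. -/
theorem simplexSpline_of_area_eq_zero (v : Fin 3 → Plane) (cell : Plane → Set Plane)
    (m : Fin 10 → ℕ) (h : area (knotHull v m) = 0) (x : Plane) :
    simplexSpline v cell m x = 0 := by
  unfold simplexSpline
  cases (∑ j, m j) - 3 <;> simp [simplexSplineAux, h]

/-- The simplex spline of three affinely independent knots. -/
theorem simplexSpline_of_card_eq_three (v : Fin 3 → Plane) (cell : Plane → Set Plane)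
    (m : Fin 10 → ℕ) (h : area (knotHull v m) ≠ 0) (hm : ∑ j, m j = 3) (x : Plane) :
    simplexSpline v cell m x =
      (halfOpenHull v cell m).indicator 1 x * (area (macroTriangle v) / area (knotHull v m)) := by
  simp [simplexSpline, hm, simplexSplineAux, h]

/-- The recursion for simplex splines with more than three knots. -/
theorem simplexSpline_of_three_lt_card (v : Fin 3 → Plane) (cell : Plane → Set Plane)
    (m : Fin 10 → ℕ) (h : area (knotHull v m) ≠ 0) (hm : 3 < ∑ j, m j) (x : Plane) :
    simplexSpline v cell m x =
      ∑ j, knotCoord v m x j * simplexSpline v cell (removeKnot m j) x := by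
  obtain ⟨n, hn⟩ : ∃ n, ∑ j, m j = n + 4 := ⟨_, (Nat.sub_add_cancel hm).symm⟩
  have e : (∑ j, m j) - 3 = n + 1 := by omega
  rw [simplexSpline, e, simplexSplineAux, if_neg h]
  refine Finset.sum_congr rfl fun j _ => ?_
  by_cases hj : m j = 0
  · rw [(knotCoord_spec v m x h).2.2 j hj, zero_mul, zero_mul]
  · have e' : (∑ i, removeKnot m j i) - 3 = n := by
      have h1 := Finset.add_sum_erase Finset.univ m (Finset.mem_univ j)
      have h2 := Finset.add_sum_erase Finset.univ (removeKnot m j) (Finset.mem_univ j)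
      have h3 : ∑ i ∈ Finset.univ.erase j, removeKnot m j i = ∑ i ∈ Finset.univ.erase j, m i :=
        Finset.sum_congr rfl fun i hi => by
          simp [removeKnot, Function.update_of_ne (Finset.ne_of_mem_erase hi)]
      have h4 : removeKnot m j j = m j - 1 := by simp [removeKnot]
      omega
    rw [simplexSpline, e']

/-- The simplex spline `Q[v₁^i v₂^j v₃^k v₄^l v₅^m v₆^n]`. -/
noncomputable def simplexSpline₆ (v : Fin 3 → Plane) (cell : Plane → Set Plane)
    (i j k l m n : ℕ) : Plane → ℝ :=
  simplexSpline v cell ![i, j, k, l, m, n, 0, 0, 0, 0]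

/-! ### The spline space -/

/-- The space of `C^r` splines of degree `d` on the 12-split. A function on the macrotriangle is
identified with its extension by zero to the plane. -/
def splineSpace (v : Fin 3 → Plane) (r d : ℕ) : Submodule ℝ (Plane → ℝ) where
  carrier := {g | (∀ x, x ∉ macroTriangle v → g x = 0) ∧
    ContDiffOn ℝ r g (macroTriangle v) ∧
    ∀ f, ∃ p : MvPolynomial (Fin 2) ℝ, p.totalDegree ≤ d ∧
      ∀ x ∈ face v f, g x = MvPolynomial.eval (fun k => x k) p}
  zero_mem' := ⟨fun _ _ => rfl, contDiffOn_const, fun _ => ⟨0, by simp, fun _ _ => by simp⟩⟩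
  add_mem' := by
    rintro g g' ⟨h1, h2, h3⟩ ⟨h1', h2', h3'⟩
    refine ⟨fun x hx => by simp [h1 x hx, h1' x hx], h2.add h2', fun f => ?_⟩
    obtain ⟨p, hp, e⟩ := h3 f
    obtain ⟨p', hp', e'⟩ := h3' f
    exact ⟨p + p', (MvPolynomial.totalDegree_add _ _).trans (max_le hp hp'),
      fun x hx => by simp [e x hx, e' x hx]⟩
  smul_mem' := by
    rintro c g ⟨h1, h2, h3⟩
    refine ⟨fun x hx => by simp [h1 x hx], contDiffOn_const.smul h2, fun f => ?_⟩
    obtain ⟨p, hp, e⟩ := h3 f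
    exact ⟨c • p, (MvPolynomial.totalDegree_smul_le _ _).trans hp,
      fun x hx => by simp [e x hx, MvPolynomial.smul_eval]⟩

/-! ### The Hermite functionals

For `k : Fin 3` the corner `v k` has the opposing edge `[v (k + 1), v (k + 2)]`, and edge number `k`
is `[v k, v (k + 1)]`, with opposing corner `v (k + 2)` (indices modulo three). -/

/-- The directional derivative `D_u g` on the macrotriangle. -/
noncomputable def dirDeriv (v : Fin 3 → Plane) (u : Plane) (g : Plane → ℝ) : Plane → ℝ :=
  fun x => fderivWithin ℝ g (macroTriangle v) x u

/-- Labels of the 39 functionals. -/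
inductive NodalIndex
  | vertex (k : Fin 3) (i j : ℕ) (h : i + j ≤ 3)
  | quarter₁ (k : Fin 3)
  | mid (k : Fin 3)
  | quarter₂ (k : Fin 3)

/-- The direction `u_e` from the midpoint of edge number `k` to the opposing corner. -/
noncomputable def crossDir (v : Fin 3 → Plane) (k : Fin 3) : Plane :=
  v (k + 2) - (1 / 2 : ℝ) • (v k + v (k + 1))

/-- The functionals: at each corner all derivatives up to order three in the directions of the
two adjacent edges; on each edge the first cross-boundary derivative at the midpoint and the second
ones at the quarterpoints. -/
noncomputable def nodalFunctional (v : Fin 3 → Plane) : NodalIndex → (Plane → ℝ) → ℝ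
  | .vertex k i j _, g =>
    ((dirDeriv v (v (k + 1) - v k))^[i] ((dirDeriv v (v (k + 2) - v k))^[j] g)) (v k)
  | .quarter₁ k, g =>
    ((dirDeriv v (crossDir v k))^[2] g) ((1 / 4 : ℝ) • ((3 : ℝ) • v k + v (k + 1)))
  | .mid k, g =>
    dirDeriv v (crossDir v k) g ((1 / 2 : ℝ) • (v k + v (k + 1)))
  | .quarter₂ k, g =>
    ((dirDeriv v (crossDir v k))^[2] g) ((1 / 4 : ℝ) • (v k + (3 : ℝ) • v (k + 1)))

/-- The label of the value at `v (σ 0)` of the derivative of order `i` in direction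
`v (σ 1) - v (σ 0)` and order `j` in direction `v (σ 2) - v (σ 0)`. -/
def vertexIndex (σ : Equiv.Perm (Fin 3)) (i j : ℕ) (h : i + j ≤ 3 := by decide) : NodalIndex :=
  if σ 1 = σ 0 + 1 then .vertex (σ 0) i j h else .vertex (σ 0) j i (by omega)

/-- The label of the second cross-boundary derivative on the edge `[v (σ 0), v (σ 1)]` at the
quarterpoint `(3 v (σ 0) + v (σ 1)) / 4`. -/
def quarterIndex (σ : Equiv.Perm (Fin 3)) : NodalIndex :=
  if σ 1 = σ 0 + 1 then .quarter₁ (σ 0) else .quarter₂ (σ 1)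

/-- The label of the first cross-boundary derivative at the midpoint of the edge
`[v (σ 0), v (σ 1)]`. -/
def midIndex (σ : Equiv.Perm (Fin 3)) : NodalIndex :=
  if σ 1 = σ 0 + 1 then .mid (σ 0) else .mid (σ 1)

end PowellSabin

open PowellSabin

/-!
On a face of the 12-split, five applications of the recursion turn each of the eight formulas into
a linear combination of characteristic functions of triangles with polynomial coefficients. This
combination is a sum of terms `q * max ℓ 0 ^ 4`, where `q` is affine and `ℓ` is either constant or
vanishes on one of the six lines that carry the interior edges. Hence the formulas define `C³`
quintic splines, and the nodal functionals of such a sum are rational numbers that do not depend on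
the triangle; evaluating them exhibits duality, and with it linear independence.

Conversely, the polynomial pieces of a `C³` quintic spline on two neighbouring faces differ by
`A * ℓ ^ 4`, with `A` affine and `ℓ` the equation of the common edge. The jumps around an interior
vertex add up to zero, and the fourth powers of the equations of two or three lines through a point
are linearly independent over the affine functions. So `A` depends only on the line, and a spline is
a quintic polynomial plus one term `A * max ℓ 0 ^ 4` for each of the six lines. This bounds the
dimension by `21 + 6 * 3 = 39`, the number of nodal functionals.
-/

namespace PowellSabin

/-! ### Barycentric coordinates -/

/-- The point with barycentric coordinates `w` if `∑ i, w i = 1`; the vector with barycentric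
coordinates `w` if `∑ i, w i = 0`. -/
noncomputable def combo (v : Fin 3 → Plane) (w : Fin 3 → ℚ) : Plane := ∑ i, (w i : ℝ) • v i

section Barycentric

variable (T : AffineBasis (Fin 3) ℝ Plane)

/-- The homogeneous linear form with coefficients `c` in the barycentric coordinates of `T`. -/
noncomputable def affineForm (c : Fin 3 → ℚ) : Plane →ᵃ[ℝ] ℝ := ∑ i, (c i : ℝ) • T.coord i

theorem affineForm_apply (c : Fin 3 → ℚ) (x : Plane) :
    affineForm T c x = ∑ i, (c i : ℝ) * T.coord i x := by
  simp [affineForm, Fin.sum_univ_three]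

theorem coord_combo {w : Fin 3 → ℚ} (hw : ∑ i, w i = 1) (i : Fin 3) :
    T.coord i (combo T w) = w i := by
  have hw' : ∑ i, (w i : ℝ) = 1 := by exact_mod_cast hw
  rw [combo, ← Finset.univ.affineCombination_eq_linear_combination _ _ hw',
    T.coord_apply_combination_of_mem (Finset.mem_univ i) hw']

theorem affineForm_combo (c : Fin 3 → ℚ) {w : Fin 3 → ℚ} (hw : ∑ i, w i = 1) :
    affineForm T c (combo T w) = (c ⬝ᵥ w : ℚ) := by
  simp only [affineForm_apply, coord_combo T hw, dotProduct]
  push_cast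
  rfl

theorem linear_affineForm_combo (c : Fin 3 → ℚ) {d : Fin 3 → ℚ} (hd : ∑ i, d i = 0) :
    (affineForm T c).linear (combo T d) = (c ⬝ᵥ d : ℚ) := by
  have hadd : combo T (d + Pi.single 0 1) = combo T d + combo T (Pi.single 0 1) := by
    simp [combo, add_smul, Finset.sum_add_distrib]
  have hsum : ∑ i, (d + Pi.single 0 1 : Fin 3 → ℚ) i = 1 := by simp [Finset.sum_add_distrib, hd]
  have h := (affineForm T c).map_vadd (combo T (Pi.single 0 1)) (combo T d)
  rw [vadd_eq_add, vadd_eq_add, ← hadd, affineForm_combo T c hsum,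
    affineForm_combo T c (by simp), dotProduct_add] at h
  push_cast at h
  linarith

theorem sum_splitCoord (j : Fin 10) : ∑ i, splitCoord j i = 1 := by
  revert j
  decide +kernel

theorem orient_eq_det_mul (x y z : Plane) :
    orient x y z = (T.toMatrix ![x, y, z]).det * orient (T 0) (T 1) (T 2) := by
  have expand : ∀ p : Plane, ∃ a b, a = T.coord 1 p ∧ b = T.coord 2 p ∧ T.coord 0 p = 1 - a - b ∧
      ∀ i, p i = (1 - a - b) * T 0 i + a * T 1 i + b * T 2 i := by
    intro p
    have hsum := T.sum_coord_apply_eq_one p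
    rw [Fin.sum_univ_three] at hsum
    have h0 : T.coord 0 p = 1 - T.coord 1 p - T.coord 2 p := by linarith
    refine ⟨_, _, rfl, rfl, h0, fun i => ?_⟩
    have hp := T.linear_combination_coord_eq_self p
    rw [Fin.sum_univ_three, h0] at hp
    exact congrArg (fun q : Plane => q i) hp.symm
  obtain ⟨a, b, ha, hb, hab, hx⟩ := expand x
  obtain ⟨c, d, hc, hd, hcd, hy⟩ := expand y
  obtain ⟨e, f, he, hf, hef, hz⟩ := expand z
  simp only [Matrix.det_fin_three, AffineBasis.toMatrix_apply, Matrix.cons_val, ← ha, ← hb, ← hc,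
    ← hd, ← he, ← hf, hab, hcd, hef, orient, hx, hy, hz]
  ring

theorem orient_ne_zero : orient (T 0) (T 1) (T 2) ≠ 0 := by
  intro h
  have := orient_eq_det_mul T 0 (EuclideanSpace.single 0 1) (EuclideanSpace.single 1 1)
  rw [h] at this
  simp [orient] at this

theorem orient_eq_coord_mul (k : Fin 3) (x : Plane) :
    orient x (T (k + 1)) (T (k + 2)) = T.coord k x * orient (T 0) (T 1) (T 2) := by
  rw [orient_eq_det_mul T]
  fin_cases k <;> simp [Matrix.det_fin_three]

theorem orient_combo (x : Plane) {b c : Fin 3 → ℚ} (hb : ∑ i, b i = 1) (hc : ∑ i, c i = 1) :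
    orient x (combo T b) (combo T c) =
      affineForm T (crossProduct b c) x * orient (T 0) (T 1) (T 2) := by
  rw [orient_eq_det_mul T, affineForm_apply]
  congr 1
  simp only [Matrix.det_fin_three, AffineBasis.toMatrix_apply, Matrix.cons_val, coord_combo T hb,
    coord_combo T hc, Fin.sum_univ_three, cross_apply]
  push_cast
  ring

theorem orient_combo_combo {a b c : Fin 3 → ℚ} (ha : ∑ i, a i = 1) (hb : ∑ i, b i = 1)
    (hc : ∑ i, c i = 1) :
    orient (combo T a) (combo T b) (combo T c) =
      (a ⬝ᵥ crossProduct b c : ℚ) * orient (T 0) (T 1) (T 2) := by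
  rw [orient_combo T _ hb hc, affineForm_combo T _ ha, dotProduct_comm]

end Barycentric

/-! ### Subtriangles and areas -/

/-- The determinant of the barycentric coordinates of three vertices of the 12-split, that is, the
signed area of the triangle they span if the macrotriangle has area one. -/
def splitDet (a b c : Fin 10) : ℚ :=
  splitCoord a ⬝ᵥ crossProduct (splitCoord b) (splitCoord c)

section Area

theorem area_convexHull_ne_zero {s : Set Plane} (hs : s.Finite)
    (h : (interior (convexHull ℝ s)).Nonempty) : area (convexHull ℝ s) ≠ 0 :=
  (ENNReal.toReal_pos (MeasureTheory.Measure.measure_pos_of_nonempty_interior _ h).ne'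
    (hs.isCompact_convexHull (𝕜 := ℝ)).measure_lt_top.ne).ne'

/-- The corners of the reference triangle with which areas are compared. -/
noncomputable def stdCorner : Fin 3 → Plane :=
  ![0, EuclideanSpace.single 0 1, EuclideanSpace.single 1 1]

theorem area_macroTriangle (p : Fin 3 → Plane) :
    area (macroTriangle p) = |orient (p 0) (p 1) (p 2)| * area (macroTriangle stdCorner) := by
  let b := (EuclideanSpace.basisFun (Fin 2) ℝ).toBasis
  let L : Plane →ₗ[ℝ] Plane := Matrix.toLin b b
    !![p 1 0 - p 0 0, p 2 0 - p 0 0; p 1 1 - p 0 1, p 2 1 - p 0 1]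
  have hL : ∀ x, L x = x 0 • (p 1 - p 0) + x 1 • (p 2 - p 0) := by
    intro x
    ext i
    fin_cases i <;>
      simp [L, b, Matrix.toLin_apply, Matrix.mulVec, dotProduct, Fin.sum_univ_two] <;> ring
  have himage : p = (p 0 + ·) ∘ L ∘ stdCorner := by
    funext i
    fin_cases i <;> simp [stdCorner, hL]
  have hhull : macroTriangle p = (p 0 + ·) '' (L '' macroTriangle stdCorner) := by
    conv_lhs => rw [himage]
    rw [macroTriangle, macroTriangle, L.image_convexHull, ← Set.range_comp, Set.range_comp]
    exact convexHull_vadd (p 0) _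
  have hdet : LinearMap.det L = orient (p 0) (p 1) (p 2) := by
    simp only [L, LinearMap.det_toLin, Matrix.det_fin_two_of, orient]
  rw [area, hhull, Set.image_add_left, MeasureTheory.measure_preimage_add,
    MeasureTheory.Measure.addHaar_image_linearMap, hdet, ENNReal.toReal_mul,
    ENNReal.toReal_ofReal (abs_nonneg _), area]

variable (T : AffineBasis (Fin 3) ℝ Plane)

theorem interior_macroTriangle_nonempty : (interior (macroTriangle T)).Nonempty :=
  interior_convexHull_nonempty_iff_affineSpan_eq_top.2 T.tot

theorem uniqueDiffOn_macroTriangle : UniqueDiffOn ℝ (macroTriangle T) :=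
  uniqueDiffOn_convex (convex_convexHull ℝ _) (interior_macroTriangle_nonempty T)

theorem area_macroTriangle_ne_zero : area (macroTriangle T) ≠ 0 :=
  area_convexHull_ne_zero (Set.finite_range T) (interior_macroTriangle_nonempty T)

theorem orient_splitPoint (a b c : Fin 10) :
    orient (splitPoint T a) (splitPoint T b) (splitPoint T c) =
      splitDet a b c * orient (T 0) (T 1) (T 2) :=
  orient_combo_combo T (sum_splitCoord a) (sum_splitCoord b) (sum_splitCoord c)

variable {a b c : Fin 10}

/-- The triangle spanned by three affinely independent vertices of the 12-split. -/
noncomputable def splitTriangle (h : splitDet a b c ≠ 0) : AffineBasis (Fin 3) ℝ Plane :=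
  have hunit : IsUnit (T.toMatrix ![splitPoint T a, splitPoint T b, splitPoint T c]) := by
    rw [Matrix.isUnit_iff_isUnit_det, isUnit_iff_ne_zero]
    refine left_ne_zero_of_mul (b := orient (T 0) (T 1) (T 2)) ?_
    rw [← orient_eq_det_mul, orient_splitPoint]
    exact mul_ne_zero (mod_cast h) (orient_ne_zero T)
  ⟨![splitPoint T a, splitPoint T b, splitPoint T c],
    ((T.isUnit_toMatrix_iff _).1 hunit).1, ((T.isUnit_toMatrix_iff _).1 hunit).2⟩

theorem coe_splitTriangle (h : splitDet a b c ≠ 0) :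
    ⇑(splitTriangle T h) = ![splitPoint T a, splitPoint T b, splitPoint T c] := rfl

theorem area_div_area_splitTriangle (h : splitDet a b c ≠ 0) :
    area (macroTriangle T) / area (macroTriangle (splitTriangle T h)) =
      ((|splitDet a b c|⁻¹ : ℚ) : ℝ) := by
  have hstd : area (macroTriangle stdCorner) ≠ 0 :=
    right_ne_zero_of_mul (area_macroTriangle T ▸ area_macroTriangle_ne_zero T)
  have horient := abs_ne_zero.2 (orient_ne_zero T)
  have hsplit : |(splitDet a b c : ℝ)| ≠ 0 := abs_ne_zero.2 (mod_cast h)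
  have hcorners : orient (splitTriangle T h 0) (splitTriangle T h 1) (splitTriangle T h 2) =
      splitDet a b c * orient (T 0) (T 1) (T 2) := orient_splitPoint T a b c
  rw [area_macroTriangle, area_macroTriangle (splitTriangle T h), hcorners, abs_mul]
  push_cast
  field_simp

theorem coord_splitTriangle (h : splitDet a b c ≠ 0) (k : Fin 3) (x : Plane) :
    (splitTriangle T h).coord k x =
      affineForm T (crossProduct (splitCoord (![a, b, c] (k + 1)))
        (splitCoord (![a, b, c] (k + 2)))) x / splitDet a b c := by
  have hcoord := orient_eq_coord_mul (splitTriangle T h) k x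
  rw [← div_eq_iff (orient_ne_zero _)] at hcoord
  rw [← hcoord]
  have hne := orient_ne_zero T
  have hcorners : orient (splitTriangle T h 0) (splitTriangle T h 1) (splitTriangle T h 2) =
      splitDet a b c * orient (T 0) (T 1) (T 2) := orient_splitPoint T a b c
  have hpoint : ∀ i, splitTriangle T h i = combo T (splitCoord (![a, b, c] i)) := by
    intro i
    fin_cases i <;> rfl
  rw [hcorners, hpoint, hpoint, orient_combo T x (sum_splitCoord _) (sum_splitCoord _),
    mul_div_mul_right _ _ hne]

end Area

section Faces

variable (T : AffineBasis (Fin 3) ℝ Plane)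

theorem splitDet_faceVertex_ne_zero (f : Fin 12) :
    splitDet (faceVertex f 0) (faceVertex f 1) (faceVertex f 2) ≠ 0 := by
  revert f
  decide +kernel

/-- The corners of a face, as a basis for barycentric coordinates. -/
noncomputable def faceBasis (f : Fin 12) : AffineBasis (Fin 3) ℝ Plane :=
  splitTriangle T (splitDet_faceVertex_ne_zero f)

theorem macroTriangle_faceBasis (f : Fin 12) : macroTriangle (faceBasis T f) = face T f := by
  rw [macroTriangle, face, faceBasis, coe_splitTriangle]
  congr 2
  funext k
  fin_cases k <;> rfl

theorem uniqueDiffOn_face (f : Fin 12) : UniqueDiffOn ℝ (face T f) :=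
  macroTriangle_faceBasis T f ▸ uniqueDiffOn_macroTriangle (faceBasis T f)

theorem splitPoint_mem_face (v : Fin 3 → Plane) (f : Fin 12) (k : Fin 3) :
    splitPoint v (faceVertex f k) ∈ face v f :=
  subset_convexHull ℝ _ ⟨k, rfl⟩

theorem exists_mem_face {v : Fin 3 → Plane} {x : Plane} (hx : x ∈ macroTriangle v) :
    ∃ f, x ∈ face v f := by
  obtain ⟨cell, hcell⟩ := exists_isFaceAssignment v
  obtain ⟨hmem, f, hf⟩ := hcell x hx
  exact ⟨f, hf ▸ hmem⟩

theorem combo_mem_macroTriangle (v : Fin 3 → Plane) {w : Fin 3 → ℚ} (hw : ∑ i, w i = 1)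
    (h0 : ∀ i, 0 ≤ w i) : combo v w ∈ macroTriangle v :=
  (convex_convexHull ℝ _).sum_mem (fun i _ => mod_cast h0 i) (mod_cast hw)
    fun i _ => subset_convexHull ℝ _ ⟨i, rfl⟩

theorem face_subset_macroTriangle (v : Fin 3 → Plane) (f : Fin 12) :
    face v f ⊆ macroTriangle v := by
  refine convexHull_min ?_ (convex_convexHull ℝ _)
  rintro _ ⟨k, rfl⟩
  have hnonneg : ∀ j i, 0 ≤ splitCoord j i := by decide +kernel
  exact combo_mem_macroTriangle v (sum_splitCoord _) (hnonneg _)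

theorem affineForm_nonneg_of_mem_face {c : Fin 3 → ℚ} {f : Fin 12}
    (hc : ∀ k, 0 ≤ c ⬝ᵥ splitCoord (faceVertex f k)) {x : Plane} (hx : x ∈ face T f) :
    0 ≤ affineForm T c x := by
  have hconv : Convex ℝ (affineForm T c ⁻¹' Set.Ici 0) := (convex_Ici 0).affine_preimage _
  refine convexHull_min ?_ hconv hx
  rintro _ ⟨k, rfl⟩
  have h := affineForm_combo T c (sum_splitCoord (faceVertex f k))
  rw [Set.mem_preimage, Set.mem_Ici]
  exact h ▸ mod_cast hc k

end Faces

/-! ### Coefficient lists -/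

/-- Horner evaluation at `t` of a list of coefficients, constant coefficient first, where `ev`
evaluates a single coefficient. -/
def horner {A R : Type*} [Semiring R] (ev : A → R) (t : R) (p : List A) : R :=
  p.foldr (fun a s => ev a + t * s) 0

/-- Coefficientwise addition of coefficient lists of possibly different lengths. -/
def addList {A : Type*} (add : A → A → A) : List A → List A → List A
  | [], q => q
  | p, [] => p
  | a :: p, b :: q => add a b :: addList add p q

section Horner

variable {A R : Type*} [CommSemiring R] {ev : A → R} (t : R)

theorem horner_cons (a : A) (p : List A) : horner ev t (a :: p) = ev a + t * horner ev t p := rfl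

theorem horner_addList {add : A → A → A} (hadd : ∀ a b, ev (add a b) = ev a + ev b)
    (p q : List A) : horner ev t (addList add p q) = horner ev t p + horner ev t q := by
  induction p, q using addList.induct with
  | case1 q => simp [addList, horner]
  | case2 p _ => cases p <;> simp [addList, horner]
  | case3 a p b q ih =>
    simp only [addList, horner_cons, ih, hadd]
    ring

theorem horner_map {g : A → A} {k : R} (hg : ∀ a, ev (g a) = k * ev a) (p : List A) :
    horner ev t (p.map g) = k * horner ev t p := by
  induction p with
  | nil => simp [horner]
  | cons a p ih =>
    simp only [List.map_cons, horner_cons, ih, hg]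
    ring

theorem horner_eq_zero {p : List A} (hp : ∀ a ∈ p, ev a = 0) : horner ev t p = 0 := by
  induction p with
  | nil => rfl
  | cons a p ih =>
    rw [List.forall_mem_cons] at hp
    rw [horner_cons, hp.1, ih hp.2, mul_zero, add_zero]

end Horner

/-- A linear form with integer coefficients, viewed over the rational numbers. -/
def castForm (c : Fin 3 → ℤ) : Fin 3 → ℚ := fun i => c i

/-- Polynomials with integer coefficients on the plane: `p[j][i]` is the coefficient of
`w₁ ^ i * w₂ ^ j`, where `w₀ = 1 - w₁ - w₂`, `w₁`, `w₂` are barycentric coordinates. -/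
abbrev PlanePoly := List (List ℤ)

namespace PlanePoly

/-- Addition of polynomials. -/
def add : PlanePoly → PlanePoly → PlanePoly := addList (addList (· + ·))

/-- Multiplication of a polynomial by an integer. -/
def smul (c : ℤ) (p : PlanePoly) : PlanePoly := p.map (·.map (c * ·))

/-- Multiplication of a polynomial by `c₀ w₀ + c₁ w₁ + c₂ w₂`. -/
def mulForm (c : Fin 3 → ℤ) (p : PlanePoly) : PlanePoly :=
  (p.smul (c 0)).add (add ((p.smul (c 1 - c 0)).map (0 :: ·)) ([] :: p.smul (c 2 - c 0)))

/-- The sum of a list of polynomials. -/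
def sum (ps : List PlanePoly) : PlanePoly := ps.foldr add []

variable (T : AffineBasis (Fin 3) ℝ Plane) (x : Plane)

/-- The value of a polynomial at a point of the plane. -/
noncomputable def eval (p : PlanePoly) : ℝ :=
  horner (horner (Int.cast : ℤ → ℝ) (T.coord 1 x)) (T.coord 2 x) p

theorem eval_add (p q : PlanePoly) : eval T x (p.add q) = eval T x p + eval T x q :=
  horner_addList _ (horner_addList _ Int.cast_add) p q

theorem eval_smul (c : ℤ) (p : PlanePoly) : eval T x (p.smul c) = c * eval T x p :=
  horner_map _ (horner_map _ (Int.cast_mul c)) p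

theorem eval_sum (ps : List PlanePoly) : eval T x (sum ps) = (ps.map (eval T x)).sum := by
  induction ps with
  | nil => rfl
  | cons p ps ih => rw [sum, List.foldr_cons, eval_add, List.map_cons, List.sum_cons, ← ih, sum]

theorem eval_mulForm (c : Fin 3 → ℤ) (p : PlanePoly) :
    eval T x (p.mulForm c) = affineForm T (castForm c) x * eval T x p := by
  have hinner : ∀ p : PlanePoly, eval T x (p.map (0 :: ·)) = T.coord 1 x * eval T x p :=
    horner_map _ fun a => by simp [horner_cons]
  have houter : ∀ p : PlanePoly, eval T x ([] :: p) = T.coord 2 x * eval T x p := fun p => by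
    simp [eval, horner]
  have hsum := T.sum_coord_apply_eq_one x
  rw [Fin.sum_univ_three, ← eq_sub_iff_add_eq, ← eq_sub_iff_add_eq] at hsum
  simp only [mulForm, eval_add, hinner, houter, eval_smul, affineForm_apply, castForm,
    Fin.sum_univ_three, hsum]
  push_cast
  ring

/-- All coefficients vanish. -/
def IsZero (p : PlanePoly) : Prop := ∀ q ∈ p, ∀ a ∈ q, a = 0

instance (p : PlanePoly) : Decidable p.IsZero :=
  inferInstanceAs (Decidable (∀ q ∈ p, ∀ a ∈ q, a = 0))

theorem IsZero.eval_eq_zero {p : PlanePoly} (hp : p.IsZero) : eval T x p = 0 :=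
  horner_eq_zero _ fun q hq => horner_eq_zero _ fun a ha => by rw [hp q hq a ha, Int.cast_zero]

end PlanePoly

/-! ### Formal sums of simplex splines -/

/-- Twelve times the barycentric coordinates of the vertices of the 12-split. -/
def intCoord : Fin 10 → Fin 3 → ℤ :=
  ![![12, 0, 0], ![0, 12, 0], ![0, 0, 12], ![6, 6, 0], ![0, 6, 6], ![6, 0, 6],
    ![6, 3, 3], ![3, 6, 3], ![3, 3, 6], ![4, 4, 4]]

theorem intCoord_eq (j : Fin 10) (i : Fin 3) : (intCoord j i : ℚ) = 12 * splitCoord j i := by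
  revert i j
  decide +kernel

/-- The linear form in barycentric coordinates that vanishes on the line through `v_b`, `v_c`. -/
def lineForm (b c : Fin 10) : Fin 3 → ℤ :=
  let u := intCoord b
  let w := intCoord c
  ![u 1 * w 2 - u 2 * w 1, u 2 * w 0 - u 0 * w 2, u 0 * w 1 - u 1 * w 0]

/-- The first six vertices of the 12-split, to which the knots are restricted. -/
def knot : Fin 6 → Fin 10 := Fin.castLE (by decide)

/-- The multiplicities of the knots in a list. -/
def knotCount (l : List (Fin 6)) : Fin 10 → ℕ := fun j => (l.map knot).count j

/-- The increasing triples of affinely independent knots, in lexicographic order. -/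
def knotTriangles : List (Fin 6 × Fin 6 × Fin 6) :=
  [(0, 1, 2), (0, 1, 4), (0, 1, 5), (0, 2, 3), (0, 2, 4), (0, 3, 4), (0, 3, 5), (0, 4, 5),
    (1, 2, 3), (1, 2, 5), (1, 3, 4), (1, 3, 5), (1, 4, 5), (2, 3, 4), (2, 3, 5), (2, 4, 5),
    (3, 4, 5)]

/-- The first triple of affinely independent knots in a list. -/
def firstTriangle (l : List (Fin 6)) : Option (Fin 6 × Fin 6 × Fin 6) :=
  knotTriangles.find? fun t => t.1 ∈ l ∧ t.2.1 ∈ l ∧ t.2.2 ∈ l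

/-- The number `1 / splitDet`, which is an integer for affinely independent knots. -/
def invDet (a b c : Fin 6) : ℤ := 1728 / (lineForm (knot b) (knot c) ⬝ᵥ intCoord (knot a))

/-- A formal sum of simplex splines with polynomial coefficients. -/
abbrev FormalSum := List (List (Fin 6) × PlanePoly)

/-- `144` times the right hand side of the recursion for a single simplex spline, since `lineForm`
is `144 = 12 ^ 2` times the cross product of barycentric coordinates. -/
def expandTerm (t : List (Fin 6) × PlanePoly) : FormalSum :=
  match firstTriangle t.1 with
  | none => []
  | some (a, b, c) =>
    let q := t.2.smul (invDet a b c)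
    [(t.1.erase a, q.mulForm (lineForm (knot b) (knot c))),
      (t.1.erase b, q.mulForm (lineForm (knot c) (knot a))),
      (t.1.erase c, q.mulForm (lineForm (knot a) (knot b)))]

/-- Adding a term to a formal sum, collecting the coefficients of equal simplex splines. -/
def insertTerm (t : List (Fin 6) × PlanePoly) : FormalSum → FormalSum
  | [] => [t]
  | u :: s => if u.1 = t.1 then (u.1, u.2.add t.2) :: s else u :: insertTerm t s

/-- `144` times the right hand side of the recursion, applied to every term of a formal sum. -/
def expand (s : FormalSum) : FormalSum := (s.flatMap expandTerm).foldr insertTerm []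

/-- Whether the triangle `[v_a, v_b, v_c]` contains a face of the 12-split. -/
def CoversFace (f : Fin 12) (a b c : Fin 6) : Prop :=
  ∀ k i, 0 ≤ invDet a b c * (lineForm (![knot a, knot b, knot c] (i + 1))
    (![knot a, knot b, knot c] (i + 2)) ⬝ᵥ intCoord (faceVertex f k))

instance (f : Fin 12) (a b c : Fin 6) : Decidable (CoversFace f a b c) :=
  inferInstanceAs (Decidable (∀ _, _))

/-- The value on a face of the simplex spline of a list of three knots. -/
def leafValue (f : Fin 12) : List (Fin 6) → ℤ
  | [a, b, c] => if CoversFace f a b c then |invDet a b c| else 0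
  | _ => 0

/-- The polynomial with which a formal sum of simplex splines of three knots agrees on a face. -/
def facePoly (f : Fin 12) (s : FormalSum) : PlanePoly :=
  PlanePoly.sum (s.map fun t => t.2.smul (leafValue f t.1))

theorem knotCount_ne_zero {l : List (Fin 6)} {j : Fin 10} :
    knotCount l j ≠ 0 ↔ j ∈ l.map knot := by
  simp only [knotCount, ne_eq, List.count_eq_zero, not_not]

theorem removeKnot_knotCount (l : List (Fin 6)) (a : Fin 6) :
    removeKnot (knotCount l) (knot a) = knotCount (l.erase a) := by
  have hinj : Function.Injective knot := Fin.castLE_injective _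
  funext j
  simp only [knotCount, List.map_erase hinj, List.count_erase, removeKnot, Function.update_apply]
  by_cases h : j = knot a
  · simp [h]
  · simp [h, Ne.symm h]

theorem find?_triples_eq_firstTriangle (l : List (Fin 6)) :
    (triples.find? fun t => (t.1 ∈ l.map knot ∧ t.2.1 ∈ l.map knot ∧ t.2.2 ∈ l.map knot) ∧
      splitDet t.1 t.2.1 t.2.2 ≠ 0) =
      (firstTriangle l).map (Prod.map knot (Prod.map knot knot)) := by
  have key : ∀ l' ∈ (List.finRange 6).sublists,
      (triples.find? fun t => (t.1 ∈ l'.map knot ∧ t.2.1 ∈ l'.map knot ∧ t.2.2 ∈ l'.map knot) ∧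
        splitDet t.1 t.2.1 t.2.2 ≠ 0) =
        (firstTriangle l').map (Prod.map knot (Prod.map knot knot)) := by
    decide +kernel
  have hmem : ∀ a, a ∈ (List.finRange 6).filter (· ∈ l) ↔ a ∈ l := by simp
  have h := key ((List.finRange 6).filter (· ∈ l)) (List.mem_sublists.2 List.filter_sublist)
  simpa only [firstTriangle, List.mem_map, hmem] using h

section Recursion

variable (T : AffineBasis (Fin 3) ℝ Plane) (cell : Plane → Set Plane)

theorem knotTriple_knotCount (l : List (Fin 6)) :
    knotTriple T (knotCount l) = (firstTriangle l).map (Prod.map knot (Prod.map knot knot)) := by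
  rw [← find?_triples_eq_firstTriangle, knotTriple]
  simp only [knotCount_ne_zero, orient_splitPoint, Ne, mul_eq_zero, orient_ne_zero, or_false,
    Rat.cast_eq_zero]

theorem simplexSplineAux_eq_zero_of_firstTriangle_eq_none {l : List (Fin 6)}
    (h : firstTriangle l = none) (n : ℕ) (x : Plane) :
    simplexSplineAux T cell n (knotCount l) x = 0 := by
  have harea : area (knotHull T (knotCount l)) = 0 := by
    by_contra hne
    simpa [knotCoord, knotTriple_knotCount, h] using (knotCoord_spec T _ x hne).1
  cases n <;> simp [simplexSplineAux, harea]

theorem mem_of_firstTriangle_eq_some {l : List (Fin 6)} {a b c : Fin 6}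
    (h : firstTriangle l = some (a, b, c)) : a ∈ l ∧ b ∈ l ∧ c ∈ l := by
  simpa using List.find?_some h

theorem splitDet_ne_zero_of_firstTriangle_eq_some {l : List (Fin 6)} {a b c : Fin 6}
    (h : firstTriangle l = some (a, b, c)) : splitDet (knot a) (knot b) (knot c) ≠ 0 := by
  have key : ∀ t ∈ knotTriangles, splitDet (knot t.1) (knot t.2.1) (knot t.2.2) ≠ 0 := by
    decide +kernel
  have hmem : (a, b, c) ∈ knotTriangles := List.mem_of_find?_eq_some h
  generalize knotTriangles = L at key hmem
  exact key _ hmem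

theorem lineForm_dotProduct_intCoord (b c j : Fin 10) :
    ((lineForm b c ⬝ᵥ intCoord j : ℤ) : ℚ) = 1728 * splitDet j b c := by
  simp only [splitDet, lineForm, cross_apply, dotProduct, Fin.sum_univ_three, Matrix.cons_val]
  push_cast
  simp only [intCoord_eq]
  ring

theorem invDet_eq_inv_splitDet (a b c : Fin 6) :
    (invDet a b c : ℚ) = (splitDet (knot a) (knot b) (knot c))⁻¹ := by
  revert a b c
  decide +kernel

theorem affineForm_lineForm (b c : Fin 10) (x : Plane) :
    affineForm T (castForm (lineForm b c)) x =
      144 * affineForm T (crossProduct (splitCoord b) (splitCoord c)) x := by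
  simp only [affineForm_apply, castForm, lineForm, cross_apply, Fin.sum_univ_three, Matrix.cons_val]
  push_cast
  have h : ∀ j i, (intCoord j i : ℝ) = 12 * splitCoord j i := fun j i => mod_cast intCoord_eq j i
  simp only [h]
  ring

theorem orient_rotate (a b c : Plane) : orient a b c = orient b c a := by
  simp only [orient]
  ring

theorem knotCoord_of_knotTriple_eq_some {m : Fin 10 → ℕ} {a b c : Fin 10}
    (h : knotTriple T m = some (a, b, c)) (x : Plane) :
    knotCoord T m x =
      Pi.single a (affineForm T (crossProduct (splitCoord b) (splitCoord c)) x / splitDet a b c) +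
      Pi.single b (affineForm T (crossProduct (splitCoord c) (splitCoord a)) x / splitDet a b c) +
      Pi.single c
        (affineForm T (crossProduct (splitCoord a) (splitCoord b)) x / splitDet a b c) := by
  have hquot : ∀ b' c' : Fin 10, orient x (splitPoint T b') (splitPoint T c') /
      orient (splitPoint T a) (splitPoint T b) (splitPoint T c) =
        affineForm T (crossProduct (splitCoord b') (splitCoord c')) x / splitDet a b c :=
    fun b' c' => by
      rw [orient_splitPoint, show orient x (splitPoint T b') (splitPoint T c') = _ from
        orient_combo T x (sum_splitCoord b') (sum_splitCoord c'),
        mul_div_mul_right _ _ (orient_ne_zero T)]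
  rw [← hquot, ← hquot, ← hquot, ← orient_rotate (splitPoint T a) x,
    orient_rotate x (splitPoint T a)]
  simp only [knotCoord, h]

theorem macroTriangle_splitTriangle_subset_knotHull {m : Fin 10 → ℕ} {a b c : Fin 10}
    (h : splitDet a b c ≠ 0) (ha : m a ≠ 0) (hb : m b ≠ 0) (hc : m c ≠ 0) :
    macroTriangle (splitTriangle T h) ⊆ knotHull T m := by
  refine convexHull_mono ?_
  rintro _ ⟨i, rfl⟩
  fin_cases i
  · exact ⟨a, ha, rfl⟩
  · exact ⟨b, hb, rfl⟩
  · exact ⟨c, hc, rfl⟩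

theorem area_knotHull_ne_zero {m : Fin 10 → ℕ} {a b c : Fin 10}
    (h : splitDet a b c ≠ 0) (ha : m a ≠ 0) (hb : m b ≠ 0) (hc : m c ≠ 0) :
    area (knotHull T m) ≠ 0 :=
  area_convexHull_ne_zero ((Set.toFinite _).image _)
    ((interior_macroTriangle_nonempty _).mono
      (interior_mono (macroTriangle_splitTriangle_subset_knotHull T h ha hb hc)))

theorem simplexSplineAux_succ_knotCount {l : List (Fin 6)} {a b c : Fin 6}
    (h : firstTriangle l = some (a, b, c)) (n : ℕ) (x : Plane) :
    144 * simplexSplineAux T cell (n + 1) (knotCount l) x = invDet a b c *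
      (affineForm T (castForm (lineForm (knot b) (knot c))) x *
          simplexSplineAux T cell n (knotCount (l.erase a)) x +
        affineForm T (castForm (lineForm (knot c) (knot a))) x *
          simplexSplineAux T cell n (knotCount (l.erase b)) x +
        affineForm T (castForm (lineForm (knot a) (knot b))) x *
          simplexSplineAux T cell n (knotCount (l.erase c)) x) := by
  have hdet := splitDet_ne_zero_of_firstTriangle_eq_some h
  obtain ⟨ha, hb, hc⟩ := mem_of_firstTriangle_eq_some h
  have hcount : ∀ d ∈ l, knotCount l (knot d) ≠ 0 := fun d hd =>
    knotCount_ne_zero.2 (List.mem_map_of_mem hd)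
  have hinv : (invDet a b c : ℝ) = (splitDet (knot a) (knot b) (knot c) : ℝ)⁻¹ := by
    exact_mod_cast invDet_eq_inv_splitDet a b c
  have htriple : knotTriple T (knotCount l) = some (knot a, knot b, knot c) := by
    rw [knotTriple_knotCount, h]
    rfl
  rw [simplexSplineAux, if_neg (area_knotHull_ne_zero T hdet (hcount a ha) (hcount b hb)
    (hcount c hc)), knotCoord_of_knotTriple_eq_some T htriple]
  simp only [Pi.add_apply, add_mul, Finset.sum_add_distrib, Pi.single_apply, ite_mul, zero_mul,
    Finset.sum_ite_eq', Finset.mem_univ, if_true, removeKnot_knotCount, affineForm_lineForm, hinv]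
  ring

/-- The value at `x` of a formal sum of simplex splines with `n + 3` knots. -/
noncomputable def FormalSum.eval (n : ℕ) (x : Plane) (s : FormalSum) : ℝ :=
  (s.map fun t => t.2.eval T x * simplexSplineAux T cell n (knotCount t.1) x).sum

variable (n : ℕ) (x : Plane)

theorem eval_expandTerm (t : List (Fin 6) × PlanePoly) :
    FormalSum.eval T cell n x (expandTerm t) =
      144 * (t.2.eval T x * simplexSplineAux T cell (n + 1) (knotCount t.1) x) := by
  rw [expandTerm]
  split
  · rename_i h
    simp [FormalSum.eval, simplexSplineAux_eq_zero_of_firstTriangle_eq_none T cell h]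
  · rename_i a b c h
    rw [mul_left_comm, simplexSplineAux_succ_knotCount T cell h]
    simp only [FormalSum.eval, List.map_cons, List.map_nil, List.sum_cons, List.sum_nil,
      PlanePoly.eval_mulForm, PlanePoly.eval_smul]
    ring

theorem eval_insertTerm (t : List (Fin 6) × PlanePoly) (s : FormalSum) :
    FormalSum.eval T cell n x (insertTerm t s) =
      t.2.eval T x * simplexSplineAux T cell n (knotCount t.1) x + FormalSum.eval T cell n x s := by
  induction s with
  | nil => simp [insertTerm, FormalSum.eval]
  | cons u s ih =>
    rw [insertTerm]
    split_ifs with h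
    · simp only [FormalSum.eval, List.map_cons, List.sum_cons, PlanePoly.eval_add, h]
      ring
    · simp only [FormalSum.eval, List.map_cons, List.sum_cons] at ih ⊢
      rw [ih]
      ring

theorem eval_expand (s : FormalSum) :
    FormalSum.eval T cell n x (expand s) = 144 * FormalSum.eval T cell (n + 1) x s := by
  have hcollect : ∀ s : FormalSum,
      FormalSum.eval T cell n x (s.foldr insertTerm []) = FormalSum.eval T cell n x s := by
    intro s
    induction s with
    | nil => rfl
    | cons t s ih =>
      rw [List.foldr_cons, eval_insertTerm, ih]
      simp only [FormalSum.eval, List.map_cons, List.sum_cons]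
  rw [expand, hcollect]
  induction s with
  | nil => simp [FormalSum.eval]
  | cons t s ih =>
    have ht := eval_expandTerm T cell n x t
    simp only [FormalSum.eval, List.flatMap_cons, List.map_append, List.sum_append, List.map_cons,
      List.sum_cons, mul_add] at ih ht ⊢
    rw [ih, ht]

theorem eval_iterate_expand (k : ℕ) (s : FormalSum) :
    FormalSum.eval T cell n x (expand^[k] s) = 144 ^ k * FormalSum.eval T cell (n + k) x s := by
  induction k generalizing s with
  | zero => simp
  | succ k ih => rw [Function.iterate_succ_apply, ih, eval_expand, pow_succ, mul_assoc, add_assoc]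

variable {cell x}

theorem face_subset_macroTriangle_splitTriangle_iff {a b c : Fin 6}
    (h : splitDet (knot a) (knot b) (knot c) ≠ 0) (f : Fin 12) :
    face T f ⊆ macroTriangle (splitTriangle T h) ↔ CoversFace f a b c := by
  have hcoord : ∀ i k, 0 ≤ (splitTriangle T h).coord i (splitPoint T (faceVertex f k)) ↔
      0 ≤ invDet a b c * (lineForm (![knot a, knot b, knot c] (i + 1))
        (![knot a, knot b, knot c] (i + 2)) ⬝ᵥ intCoord (faceVertex f k)) := by
    intro i k
    have hform := lineForm_dotProduct_intCoord (![knot a, knot b, knot c] (i + 1))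
      (![knot a, knot b, knot c] (i + 2)) (faceVertex f k)
    rw [coord_splitTriangle, show splitPoint T (faceVertex f k) = combo T _ from rfl,
      affineForm_combo T _ (sum_splitCoord _), dotProduct_comm, ← splitDet,
      ← Int.cast_nonneg_iff (R := ℚ), Int.cast_mul, hform, invDet_eq_inv_splitDet, ← Rat.cast_div,
      Rat.cast_nonneg, mul_left_comm, mul_nonneg_iff_of_pos_left (by norm_num), div_eq_inv_mul]
  have hconv : Convex ℝ (macroTriangle (splitTriangle T h)) := convex_convexHull ℝ _
  rw [face, hconv.convexHull_subset_iff, Set.range_subset_iff, macroTriangle,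
    (splitTriangle T h).convexHull_eq_nonneg_coord]
  simp only [Set.mem_ofPred_eq, hcoord, CoversFace]

theorem simplexSplineAux_zero_of_cell_eq (hx : x ∈ macroTriangle T) {f : Fin 12}
    (hf : cell x = face T f) {l : List (Fin 6)} (hl : l.length = 3) :
    simplexSplineAux T cell 0 (knotCount l) x = leafValue f l := by
  obtain ⟨a, b, c, rfl⟩ := List.length_eq_three.1 hl
  have hull : knotHull T (knotCount [a, b, c]) =
      macroTriangle ![splitPoint T (knot a), splitPoint T (knot b), splitPoint T (knot c)] := by
    simp only [knotHull, knotCount_ne_zero, macroTriangle, Matrix.range_cons]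
    congr 1
    ext y
    simp only [Set.mem_image, Set.mem_ofPred_eq, List.mem_map, List.mem_cons, List.not_mem_nil,
      Set.mem_union, Set.mem_singleton_iff]
    aesop
  by_cases h : splitDet (knot a) (knot b) (knot c) = 0
  · have hinv : invDet a b c = 0 := by
      rw [← Int.cast_eq_zero (α := ℚ), invDet_eq_inv_splitDet, h, inv_zero]
    have harea : area (knotHull T (knotCount [a, b, c])) = 0 := by
      rw [hull, area_macroTriangle]
      simp [orient_splitPoint, h]
    simp [simplexSplineAux, harea, leafValue, hinv]
  · rw [← coe_splitTriangle T h] at hull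
    have hratio := area_div_area_splitTriangle T h
    rw [← abs_inv, ← invDet_eq_inv_splitDet] at hratio
    have hmem : x ∈ halfOpenHull T cell (knotCount [a, b, c]) ↔ CoversFace f a b c := by
      rw [halfOpenHull, Set.mem_ofPred_eq, hf, hull,
        face_subset_macroTriangle_splitTriangle_iff T h, and_iff_right hx]
    rw [simplexSplineAux, hull, if_neg (area_macroTriangle_ne_zero _), hratio, leafValue]
    by_cases hcov : CoversFace f a b c
    · simp [Set.indicator_of_mem (hmem.2 hcov), hcov]
    · simp [Set.indicator_of_notMem (mt hmem.1 hcov), hcov]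

theorem eval_zero_eq_eval_facePoly (hx : x ∈ macroTriangle T) {f : Fin 12}
    (hf : cell x = face T f) {s : FormalSum} (hs : ∀ t ∈ s, t.1.length = 3) :
    FormalSum.eval T cell 0 x s = (facePoly f s).eval T x := by
  rw [FormalSum.eval, facePoly, PlanePoly.eval_sum, List.map_map]
  congr 1
  refine List.map_congr_left fun t ht => ?_
  rw [simplexSplineAux_zero_of_cell_eq T hx hf (hs t ht), Function.comp_apply,
    PlanePoly.eval_smul, mul_comm]

end Recursion

/-! ### The eight formulas -/

/-- The sorted list of the knots of `Q[v₁^i v₂^j v₃^k v₄^l v₅^m v₆^n]`. -/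
def knots (i j k l m n : ℕ) : List (Fin 6) :=
  List.replicate i 0 ++ (List.replicate j 1 ++ (List.replicate k 2 ++ (List.replicate l 3 ++
    (List.replicate m 4 ++ List.replicate n 5))))

/-- A common denominator of the coefficients of each formula. -/
def formulaScale : Fin 8 → ℤ := ![48, 80, 3840, 960, 138240, 34560, 720, 90]

/-- The coefficients, multiplied by `formulaScale`, and the knots of the simplex splines in the
formulas for the nodal functions dual to the derivatives `1`, `D_x`, `D_x²`, `D_x D_y`, `D_x³`,
`D_x² D_y` at a corner, to `D_u²` at a quarterpoint, and to `D_u` at a midpoint. -/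
def formulaTerms : Fin 8 → List (ℤ × List (Fin 6)) :=
  ![
    [
      (12, knots 6 0 0 1 0 1), (12, knots 5 0 0 2 0 1), (12, knots 5 0 0 1 0 2),
      (24, knots 4 1 0 2 0 1), (24, knots 4 0 1 1 0 2), (48, knots 4 1 1 1 0 1),
      (24, knots 3 1 1 2 0 1), (24, knots 3 1 1 1 0 2), (24, knots 3 2 0 2 0 1),
      (24, knots 3 0 2 1 0 2), (27, knots 2 1 1 2 1 1), (27, knots 2 1 1 1 1 2),
      (18, knots 2 2 0 2 1 1), (18, knots 2 0 2 1 1 2), (9, knots 1 1 2 1 1 2),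
      (9, knots 1 2 1 2 1 1)],
    [
      (2, knots 5 0 0 2 0 1), (8, knots 4 1 0 2 0 1), (16, knots 3 2 0 2 0 1),
      (8, knots 4 1 1 1 0 1), (12, knots 3 1 1 2 0 1), (13, knots 2 2 0 2 1 1),
      (4, knots 3 1 1 1 0 2), (19, knots 2 1 1 2 1 1), (8, knots 1 2 1 2 1 1),
      (-2, knots 2 1 1 1 1 2), (-2, knots 2 0 2 1 1 2), (-4, knots 1 1 2 1 1 2)],
    [
      (24, knots 4 1 0 2 0 1), (120, knots 3 2 0 2 0 1), (48, knots 3 1 1 2 0 1),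
      (102, knots 2 2 0 2 1 1), (121, knots 2 1 1 2 1 1), (71, knots 1 2 1 2 1 1),
      (-80, knots 2 1 1 1 1 2), (8, knots 1 1 2 1 1 2)],
    [
      (12, knots 4 1 1 1 0 1), (18, knots 3 1 1 2 0 1), (18, knots 3 1 1 1 0 2),
      (-6, knots 2 2 0 2 1 1), (-6, knots 2 0 2 1 1 2), (17, knots 2 1 1 1 1 2),
      (17, knots 2 1 1 2 1 1), (-14, knots 1 1 2 1 1 2), (-14, knots 1 2 1 2 1 1)],
    [
      (288, knots 3 2 0 2 0 1), (252, knots 2 2 0 2 1 1), (225, knots 2 1 1 2 1 1),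
      (189, knots 1 2 1 2 1 1)],
    [
      (72, knots 3 1 1 2 0 1), (-18, knots 2 2 0 2 1 1), (-45, knots 1 2 1 2 1 1),
      (99, knots 2 1 1 2 1 1), (-99, knots 2 1 1 1 1 2), (9, knots 1 1 2 1 1 2)],
    [
      (21, knots 2 1 1 2 1 1), (-3, knots 1 2 1 2 1 1)],
    [
      (9, knots 2 2 0 2 1 1), (18, knots 2 1 1 2 1 1), (18, knots 1 2 1 2 1 1)]]

/-- The spline given by one of the eight formulas. -/
noncomputable def nodalSpline (v : Fin 3 → Plane) (cell : Plane → Set Plane) (F : Fin 8) :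
    Plane → ℝ := fun x =>
  ((formulaTerms F).map fun t => (t.1 : ℝ) * simplexSpline v cell (knotCount t.2) x).sum /
    formulaScale F

/-- The constant form and, with both signs, the forms that vanish on the interior lines of the
12-split. -/
def lineForms : List (Fin 3 → ℤ) :=
  [![1, 1, 1], ![0, 1, -1], ![-1, 0, 1], ![1, -1, 0], ![1, -1, -1], ![-1, 1, -1], ![-1, -1, 1],
    ![0, -1, 1], ![1, 0, -1], ![-1, 1, 0], ![-1, 1, 1], ![1, -1, 1], ![1, 1, -1]]

/-- Coefficients of truncated powers: on the macrotriangle, `formulaScale F` times the nodal spline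
of formula `F` is `∑ q * max ℓ 0 ^ 4`, where `ℓ` runs through `lineForms` and `q` through row `F`.
Each row solves the linear system that equates both sides on the twelve faces. -/
def truncTable : Fin 8 → List (Fin 3 → ℤ) :=
  ![
    [
      ![116, -34, -34], ![-880, 80, 80], ![-256, 320, -64], ![-16, 176, 560], ![252, 18, 18],
      ![-144, -126, 126], ![-144, 126, -126], ![-880, 80, 80], ![-16, 560, 176],
      ![-256, -64, 320], ![252, 18, 18], ![-144, -126, 126], ![-144, 126, -126]],
    [
      ![38, 8, -32], ![-160, 176, -96], ![-320, -480, -160], ![128, 432, 640], ![114, -264, 336],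
      ![-318, -32, 152], ![246, -64, -56], ![-640, 208, -128], ![-160, -240, -320],
      ![64, 96, 800], ![106, -176, 184], ![-198, -72, 192], ![78, -72, -48]],
    [
      ![30, 130, -80], ![1200, 1584, -2624], ![656, -5440, -256], ![1344, 4496, 1920],
      ![306, -2346, 3384], ![-2886, -834, 1464], ![-186, 954, -1584], ![-6720, -656, -384],
      ![-1968, -3120, -4672], ![2672, 1088, 1280], ![-854, -866, 1024], ![-990, -650, 1280],
      ![1278, -1102, 472]],
    [
      ![108, -52, -52], ![0, -192, 992], ![-1280, 1600, -320], ![0, 160, 960], ![396, 84, 84],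
      ![636, 444, -444], ![636, -444, 444], ![0, 992, -192], ![0, 960, 160], ![-1280, -320, 1600],
      ![788, -28, -28], ![-252, -148, 148], ![-252, 148, -148]],
    [
      ![382, 262, -368], ![-18800, 3568, -4928], ![-848, -12800, -1472], ![3328, 7312, 7360],
      ![-126, -3294, 2376], ![-8982, -4518, 6408], ![1062, 1422, -3312], ![-16640, 112, -1472],
      ![-848, -6320, -1472], ![5200, 2560, 7360], ![-774, -2646, 3024], ![-3150, -1710, 3600],
      ![414, 774, -2664]],
    [
      ![32, -118, 62], ![11600, -400, 1040], ![-160, 4160, 320], ![1136, 4784, -880],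
      ![792, -1602, 3258], ![2772, 1998, -2538], ![-1116, 954, -414], ![-5680, 464, 176],
      ![-2320, 2000, -6160], ![-1888, -832, -1600], ![576, 774, -846], ![-468, -1242, 702],
      ![828, -1422, 1962]],
    [
      ![54, -26, -16], ![-240, -80, 320], ![-336, 640, -64], ![384, 976, 320], ![-54, -606, 264],
      ![210, 90, -120], ![-66, 174, -144], ![-1920, 304, -64], ![48, 400, -448],
      ![-432, -128, 320], ![258, 42, -48], ![-294, -366, 336], ![-138, 102, -72]],
    [
      ![28, 28, -32], ![-560, 112, -272], ![-32, -1280, -128], ![256, 544, 640],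
      ![-144, -576, 324], ![-576, -144, 324], ![108, 108, -288], ![-1280, -32, -128],
      ![112, -560, -272], ![544, 256, 640], ![-108, -252, 288], ![-252, -108, 288], ![0, 0, -180]]]

/-- The pairs `(q, ℓ)` in the expansion of a nodal spline into truncated powers. -/
def truncForms (F : Fin 8) : List ((Fin 3 → ℤ) × (Fin 3 → ℤ)) := (truncTable F).zip lineForms

/-- A linear form is nonnegative on a face. -/
def FormNonneg (f : Fin 12) (c : Fin 3 → ℤ) : Prop := ∀ k, 0 ≤ c ⬝ᵥ intCoord (faceVertex f k)

instance (f : Fin 12) (c : Fin 3 → ℤ) : Decidable (FormNonneg f c) :=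
  inferInstanceAs (Decidable (∀ _, _))

/-- The formal sum of the characteristic functions of triangles to which the recursion reduces a
formula. -/
def formulaSum (F : Fin 8) : FormalSum :=
  expand^[5] ((formulaTerms F).map fun t => (t.2, [[t.1]]))

/-- The polynomial with which a sum of truncated powers agrees on a face. -/
def truncPoly (f : Fin 12) (L : List ((Fin 3 → ℤ) × (Fin 3 → ℤ))) : PlanePoly :=
  PlanePoly.sum ((L.filter fun t => FormNonneg f t.2).map fun t =>
    (PlanePoly.mulForm t.2)^[4] (PlanePoly.mulForm t.1 [[1]]))

set_option maxRecDepth 100000 in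
theorem isZero_facePoly_sub_truncPoly : ∀ F f, ((facePoly f (formulaSum F)).add
    ((truncPoly f (truncForms F)).smul (-144 ^ 5))).IsZero := by
  decide +kernel

set_option maxRecDepth 100000 in
theorem length_of_mem_formulaSum : ∀ F, ∀ t ∈ formulaSum F, t.1.length = 3 := by
  decide +kernel

theorem knotCount_knots (i j k l m n : ℕ) :
    knotCount (knots i j k l m n) = ![i, j, k, l, m, n, 0, 0, 0, 0] := by
  funext a
  simp only [knotCount, knots, List.map_append, List.map_replicate, List.count_append,
    List.count_replicate]
  fin_cases a <;> simp [knot]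

theorem simplexSpline_knotCount_knots (v : Fin 3 → Plane) (cell : Plane → Set Plane)
    (i j k l m n : ℕ) : simplexSpline v cell (knotCount (knots i j k l m n)) =
      simplexSpline₆ v cell i j k l m n := by
  rw [knotCount_knots, simplexSpline₆]

theorem sum_knotCount (l : List (Fin 6)) : ∑ j, knotCount l j = l.length := by
  simpa [knotCount] using Multiset.sum_count_eq_card (s := Finset.univ)
    (m := (l.map knot : Multiset (Fin 10))) fun a _ => Finset.mem_univ a

/-- The expansion of a nodal spline into truncated powers, with rational coefficients. -/
def truncTerms (F : Fin 8) : List ((Fin 3 → ℚ) × (Fin 3 → ℚ)) :=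
  (truncForms F).map (Prod.map castForm castForm)

section

variable (T : AffineBasis (Fin 3) ℝ Plane)

/-- The sum of the truncated powers `q * max ℓ 0 ^ n`, for a list of pairs `(q, ℓ)` of linear forms
in the barycentric coordinates of `T`. -/
noncomputable def truncSum (n : ℕ) (L : List ((Fin 3 → ℚ) × (Fin 3 → ℚ))) (x : Plane) : ℝ :=
  (L.map fun t => affineForm T t.1 x * max (affineForm T t.2 x) 0 ^ n).sum

variable {T} {f : Fin 12} {x : Plane}

theorem FormNonneg.affineForm_nonneg {c : Fin 3 → ℤ} (hc : FormNonneg f c) (hx : x ∈ face T f) :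
    0 ≤ affineForm T (castForm c) x := by
  refine affineForm_nonneg_of_mem_face T (fun k => ?_) hx
  have h : ((c ⬝ᵥ intCoord (faceVertex f k) : ℤ) : ℚ) =
      12 * (castForm c ⬝ᵥ splitCoord (faceVertex f k)) := by
    simp only [dotProduct, castForm, Finset.mul_sum]
    push_cast
    exact Finset.sum_congr rfl fun i _ => by rw [intCoord_eq]; ring
  have h0 : (0 : ℚ) ≤ (c ⬝ᵥ intCoord (faceVertex f k) : ℤ) := mod_cast hc k
  linarith

theorem affineForm_castForm_neg (c : Fin 3 → ℤ) (x : Plane) :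
    affineForm T (castForm (-c)) x = -affineForm T (castForm c) x := by
  simp [affineForm_apply, castForm]

theorem formNonneg_or_formNonneg_neg {c : Fin 3 → ℤ} (hc : c ∈ lineForms) (f : Fin 12) :
    FormNonneg f c ∨ FormNonneg f (-c) := by
  have key : ∀ c ∈ lineForms, ∀ f, FormNonneg f c ∨ FormNonneg f (-c) := by decide +kernel
  exact key c hc f

theorem max_affineForm_of_mem_face {c : Fin 3 → ℤ} (hc : c ∈ lineForms) (hx : x ∈ face T f) :
    max (affineForm T (castForm c) x) 0 =
      if FormNonneg f c then affineForm T (castForm c) x else 0 := by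
  split_ifs with h
  · exact max_eq_left (h.affineForm_nonneg hx)
  · have hneg := ((formNonneg_or_formNonneg_neg hc f).resolve_left h).affineForm_nonneg hx
    rw [affineForm_castForm_neg] at hneg
    exact max_eq_right (neg_nonneg.1 hneg)

theorem eval_truncPoly {L : List ((Fin 3 → ℤ) × (Fin 3 → ℤ))} (hL : ∀ t ∈ L, t.2 ∈ lineForms)
    (hx : x ∈ face T f) :
    (truncPoly f L).eval T x = truncSum T 4 (L.map (Prod.map castForm castForm)) x := by
  have hterm : ∀ q c : Fin 3 → ℤ,
      PlanePoly.eval T x ((PlanePoly.mulForm c)^[4] (PlanePoly.mulForm q [[1]])) =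
        affineForm T (castForm q) x * affineForm T (castForm c) x ^ 4 := by
    intro q c
    have hone : PlanePoly.eval T x [[1]] = 1 := by simp [PlanePoly.eval, horner]
    simp only [Function.iterate_succ_apply, Function.iterate_zero_apply, PlanePoly.eval_mulForm,
      hone]
    ring
  simp only [truncPoly, PlanePoly.eval_sum, truncSum, List.map_map]
  induction L with
  | nil => rfl
  | cons t L ih =>
    rw [List.forall_mem_cons] at hL
    have hmax := max_affineForm_of_mem_face hL.1 hx
    rw [List.filter_cons, List.map_cons, List.sum_cons, ← ih hL.2]
    by_cases h : FormNonneg f t.2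
    · rw [if_pos h] at hmax
      simp only [h, decide_true, if_true, List.map_cons, List.sum_cons, Function.comp_apply, hterm,
        Prod.map_fst, Prod.map_snd, hmax]
    · rw [if_neg h] at hmax
      simp [h, hmax]

theorem mem_lineForms_of_mem_truncForms {F : Fin 8} {t : (Fin 3 → ℤ) × (Fin 3 → ℤ)}
    (ht : t ∈ truncForms F) : t.2 ∈ lineForms := (List.of_mem_zip ht).2

theorem nodalSpline_eq_truncSum {cell : Plane → Set Plane} (hcell : IsFaceAssignment T cell)
    (F : Fin 8) (hx : x ∈ macroTriangle T) :
    nodalSpline T cell F x = truncSum T 4 (truncTerms F) x / formulaScale F := by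
  obtain ⟨hmem, f, hf⟩ := hcell x hx
  have hlength : ∀ F, ∀ t ∈ formulaTerms F, t.2.length = 8 := by decide +kernel
  have hzero := (isZero_facePoly_sub_truncPoly F f).eval_eq_zero T x
  rw [PlanePoly.eval_add, PlanePoly.eval_smul,
    ← eval_zero_eq_eval_facePoly T hx hf (length_of_mem_formulaSum F),
    eval_truncPoly (fun t => mem_lineForms_of_mem_truncForms) (hf ▸ hmem), formulaSum,
    eval_iterate_expand] at hzero
  push_cast at hzero
  have hsum : FormalSum.eval T cell (0 + 5) x ((formulaTerms F).map fun t => (t.2, [[t.1]])) =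
      truncSum T 4 (truncTerms F) x := by
    rw [truncTerms]
    linarith
  rw [nodalSpline, ← hsum, FormalSum.eval, List.map_map]
  congr 2
  refine List.map_congr_left fun t ht => ?_
  simp [simplexSpline, sum_knotCount, hlength F t ht, PlanePoly.eval, horner]

end

/-! ### Smoothness of the nodal splines -/

theorem hasDerivAt_max_zero_pow (n : ℕ) (x : ℝ) :
    HasDerivAt (fun y : ℝ => max y 0 ^ (n + 2)) ((n + 2 : ℕ) * max x 0 ^ (n + 1)) x := by
  have hpos : ∀ y : ℝ, 0 ≤ y → max y 0 ^ (n + 2) = y ^ (n + 2) := fun y hy => by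
    rw [max_eq_left hy]
  have hneg : ∀ y : ℝ, y ≤ 0 → max y 0 ^ (n + 2) = 0 := fun y hy => by
    rw [max_eq_right hy, zero_pow (by omega)]
  rcases lt_trichotomy x 0 with hx | rfl | hx
  · rw [max_eq_right hx.le, zero_pow (by omega), mul_zero]
    refine (hasDerivAt_const x (0 : ℝ)).congr_of_eventuallyEq ?_
    filter_upwards [Iio_mem_nhds hx] with y hy using hneg y (le_of_lt hy)
  · have hleft : HasDerivWithinAt (fun y : ℝ => max y 0 ^ (n + 2)) 0 (Set.Iic 0) 0 :=
      (hasDerivWithinAt_const (0 : ℝ) _ (0 : ℝ)).congr (fun y hy => hneg y hy) (hneg 0 le_rfl)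
    have hright : HasDerivWithinAt (fun y : ℝ => max y 0 ^ (n + 2)) 0 (Set.Ici 0) 0 := by
      simpa using ((hasDerivAt_pow (n + 2) (0 : ℝ)).hasDerivWithinAt (s := Set.Ici 0)).congr
        (fun y hy => hpos y hy) (hpos 0 le_rfl)
    have hunion := hleft.union hright
    rw [Set.Iic_union_Ici, hasDerivWithinAt_univ] at hunion
    simpa using hunion
  · rw [max_eq_left hx.le]
    refine (hasDerivAt_pow (n + 2) x).congr_of_eventuallyEq ?_
    filter_upwards [Ioi_mem_nhds hx] with y hy using hpos y (le_of_lt hy)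

theorem contDiff_max_zero_pow (n : ℕ) : ContDiff ℝ n fun y : ℝ => max y 0 ^ (n + 1) := by
  induction n with
  | zero =>
    rw [Nat.cast_zero, contDiff_zero]
    fun_prop
  | succ n ih =>
    have hderiv : deriv (fun y : ℝ => max y 0 ^ (n + 1 + 1)) =
        fun y => ((n + 2 : ℕ) : ℝ) * max y 0 ^ (n + 1) :=
      funext fun x => (hasDerivAt_max_zero_pow n x).deriv
    rw [Nat.cast_succ, contDiff_succ_iff_deriv, hderiv]
    exact ⟨fun x => (hasDerivAt_max_zero_pow n x).differentiableAt, by simp,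
      contDiff_const.mul ih⟩

theorem hasFDerivAt_affineMap (A : Plane →ᵃ[ℝ] ℝ) (x : Plane) :
    HasFDerivAt A A.linear.toContinuousLinearMap x := by
  rw [A.decomp]
  exact A.linear.toContinuousLinearMap.hasFDerivAt.add_const (A 0)

theorem contDiff_affineMap (A : Plane →ᵃ[ℝ] ℝ) {n : WithTop ℕ∞} : ContDiff ℝ n A :=
  (⟨A, A.continuous_of_finiteDimensional⟩ : Plane →ᴬ[ℝ] ℝ).contDiff

/-- The polynomial of total degree at most one whose evaluation is the affine map `A`. -/
noncomputable def affinePoly (A : Plane →ᵃ[ℝ] ℝ) : MvPolynomial (Fin 2) ℝ :=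
  ∑ k, MvPolynomial.C (A.linear (EuclideanSpace.single k 1)) * MvPolynomial.X k +
    MvPolynomial.C (A 0)

theorem affineMap_apply_eq (A : Plane →ᵃ[ℝ] ℝ) (x : Plane) :
    A x = A.linear (EuclideanSpace.single 0 1) * x 0 +
      A.linear (EuclideanSpace.single 1 1) * x 1 + A 0 := by
  have hx : x = x 0 • EuclideanSpace.single 0 1 + x 1 • EuclideanSpace.single 1 1 := by
    ext i
    fin_cases i <;> simp
  have hA := congrFun A.decomp x
  rw [Pi.add_apply] at hA
  rw [hA]
  conv_lhs => rw [hx]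
  simp [mul_comm]

theorem eval_affinePoly (A : Plane →ᵃ[ℝ] ℝ) (x : Plane) :
    MvPolynomial.eval (fun k => x k) (affinePoly A) = A x := by
  rw [affineMap_apply_eq A x]
  simp [affinePoly]

theorem totalDegree_affinePoly_le (A : Plane →ᵃ[ℝ] ℝ) : (affinePoly A).totalDegree ≤ 1 := by
  open MvPolynomial in
  refine (totalDegree_add _ _).trans (max_le (totalDegree_finsetSum_le fun k _ => ?_) ?_)
  · simpa using totalDegree_mul (C (A.linear (EuclideanSpace.single k 1))) (X k)
  · simp

section

variable (T : AffineBasis (Fin 3) ℝ Plane)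

theorem contDiff_truncSum (n : ℕ) (L : List ((Fin 3 → ℚ) × (Fin 3 → ℚ))) :
    ContDiff ℝ n (truncSum T (n + 1) L) := by
  induction L with
  | nil => exact contDiff_const
  | cons t L ih =>
    have hcons : truncSum T (n + 1) (t :: L) = fun x =>
        affineForm T t.1 x * max (affineForm T t.2 x) 0 ^ (n + 1) + truncSum T (n + 1) L x :=
      funext fun x => by simp [truncSum]
    rw [hcons]
    exact ((contDiff_affineMap _).mul
      ((contDiff_max_zero_pow n).comp (contDiff_affineMap _))).add ih

variable {T}

theorem exists_poly_truncTerm {c : Fin 3 → ℤ} (hc : c ∈ lineForms) (A : Plane →ᵃ[ℝ] ℝ)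
    (f : Fin 12) : ∃ p : MvPolynomial (Fin 2) ℝ, p.totalDegree ≤ 5 ∧ ∀ x ∈ face T f,
      A x * max (affineForm T (castForm c) x) 0 ^ 4 = MvPolynomial.eval (fun k => x k) p := by
  refine ⟨if FormNonneg f c then affinePoly A * affinePoly (affineForm T (castForm c)) ^ 4 else 0,
    ?_, fun x hx => ?_⟩
  · split_ifs
    · have hA := totalDegree_affinePoly_le A
      have hc := totalDegree_affinePoly_le (affineForm T (castForm c))
      have hmul := MvPolynomial.totalDegree_mul (affinePoly A)
        (affinePoly (affineForm T (castForm c)) ^ 4)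
      have hpow := MvPolynomial.totalDegree_pow (affinePoly (affineForm T (castForm c))) 4
      omega
    · simp
  · rw [max_affineForm_of_mem_face hc hx]
    split_ifs <;> simp [eval_affinePoly]

theorem exists_poly_truncSum {L : List ((Fin 3 → ℤ) × (Fin 3 → ℤ))}
    (hL : ∀ t ∈ L, t.2 ∈ lineForms) (f : Fin 12) :
    ∃ p : MvPolynomial (Fin 2) ℝ, p.totalDegree ≤ 5 ∧ ∀ x ∈ face T f,
      truncSum T 4 (L.map (Prod.map castForm castForm)) x =
        MvPolynomial.eval (fun k => x k) p := by
  induction L with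
  | nil => exact ⟨0, by simp, by simp [truncSum]⟩
  | cons t L ih =>
    rw [List.forall_mem_cons] at hL
    obtain ⟨p, hp, hpL⟩ := ih hL.2
    obtain ⟨q, hq, hqt⟩ := exists_poly_truncTerm hL.1 (affineForm T (castForm t.1)) f
    refine ⟨q + p, (MvPolynomial.totalDegree_add _ _).trans (max_le hq hp), fun x hx => ?_⟩
    rw [map_add, ← hqt x hx, ← hpL x hx]
    simp [truncSum]

theorem simplexSplineAux_of_notMem {v : Fin 3 → Plane} (cell : Plane → Set Plane) {x : Plane}
    (hx : x ∉ macroTriangle v) (n : ℕ) (m : Fin 10 → ℕ) : simplexSplineAux v cell n m x = 0 := by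
  induction n generalizing m with
  | zero =>
    have hx' : x ∉ halfOpenHull v cell m := fun h => hx h.1
    simp [simplexSplineAux, hx']
  | succ n ih => simp [simplexSplineAux, ih]

theorem nodalSpline_mem_splineSpace {cell : Plane → Set Plane} (hcell : IsFaceAssignment T cell)
    (F : Fin 8) : nodalSpline T cell F ∈ splineSpace T 3 5 := by
  refine ⟨fun x hx => ?_, ?_, fun f => ?_⟩
  · simp [nodalSpline, simplexSpline, simplexSplineAux_of_notMem cell hx]
  · exact ((contDiff_truncSum T 3 (truncTerms F)).div_const _).contDiffOn.congr
      fun x hx => nodalSpline_eq_truncSum hcell F hx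
  · obtain ⟨p, hp, hpF⟩ := exists_poly_truncSum (T := T) (L := truncForms F)
      (fun t ht => mem_lineForms_of_mem_truncForms ht) f
    refine ⟨(formulaScale F : ℝ)⁻¹ • p, (MvPolynomial.totalDegree_smul_le _ _).trans hp,
      fun x hx => ?_⟩
    rw [nodalSpline_eq_truncSum hcell F (face_subset_macroTriangle T f hx), truncTerms, hpF x hx,
      MvPolynomial.smul_eval, div_eq_inv_mul]

end

/-! ### Duality -/

instance : DecidableEq NodalIndex
  | .vertex k i j _, .vertex k' i' j' _ =>
    decidable_of_iff (k = k' ∧ i = i' ∧ j = j') (by simp)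
  | .quarter₁ k, .quarter₁ k' | .mid k, .mid k' | .quarter₂ k, .quarter₂ k' =>
    decidable_of_iff (k = k') (by simp)
  | .vertex .., .quarter₁ _ | .vertex .., .mid _ | .vertex .., .quarter₂ _
  | .quarter₁ _, .vertex .. | .quarter₁ _, .mid _ | .quarter₁ _, .quarter₂ _
  | .mid _, .vertex .. | .mid _, .quarter₁ _ | .mid _, .quarter₂ _
  | .quarter₂ _, .vertex .. | .quarter₂ _, .quarter₁ _ | .quarter₂ _, .mid _ => isFalse nofun

/-- The list of the labels of the 39 functionals. -/
def NodalIndex.all : List NodalIndex :=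
  (List.finRange 3).flatMap fun k => [.quarter₁ k, .mid k, .quarter₂ k] ++
    (List.finRange 4).flatMap fun i : Fin 4 =>
      (List.finRange (4 - i.1)).map fun j => .vertex k i j (by omega)

theorem NodalIndex.mem_all (μ : NodalIndex) : μ ∈ all := by
  cases μ with
  | vertex k i j h =>
    have hj : j < 4 - i := by omega
    exact List.mem_flatMap.2 ⟨k, List.mem_finRange k, List.mem_append_right _ <|
      List.mem_flatMap.2 ⟨⟨i, by omega⟩, List.mem_finRange _,
        List.mem_map.2 ⟨⟨j, hj⟩, List.mem_finRange _, rfl⟩⟩⟩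
  | _ => simp [all]

instance : Fintype NodalIndex := ⟨⟨NodalIndex.all, by decide⟩, NodalIndex.mem_all⟩

theorem card_nodalIndex : Fintype.card NodalIndex = 39 := by decide

/-- Barycentric coordinates of the point at which a functional is evaluated. -/
def NodalIndex.point : NodalIndex → Fin 3 → ℚ
  | .vertex k _ _ _ => Pi.single k 1
  | .quarter₁ k => Pi.single k (3 / 4) + Pi.single (k + 1) (1 / 4)
  | .mid k => Pi.single k (1 / 2) + Pi.single (k + 1) (1 / 2)
  | .quarter₂ k => Pi.single k (1 / 4) + Pi.single (k + 1) (3 / 4)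

/-- Barycentric coordinates of `crossDir`. -/
def crossCoord (k : Fin 3) : Fin 3 → ℚ :=
  Pi.single (k + 2) 1 - (Pi.single k (1 / 2) + Pi.single (k + 1) (1 / 2))

/-- Barycentric coordinates of the directions in which a functional differentiates. -/
def NodalIndex.directions : NodalIndex → List (Fin 3 → ℚ)
  | .vertex k i j _ => List.replicate i (Pi.single (k + 1) 1 - Pi.single k 1) ++
      List.replicate j (Pi.single (k + 2) 1 - Pi.single k 1)
  | .quarter₁ k => [crossCoord k, crossCoord k]
  | .mid k => [crossCoord k]
  | .quarter₂ k => [crossCoord k, crossCoord k]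

/-- The labels of the functionals to which the eight formulas, relabelled by `σ`, are dual. -/
def formulaIndex (σ : Equiv.Perm (Fin 3)) : Fin 8 → NodalIndex :=
  ![vertexIndex σ 0 0, vertexIndex σ 1 0, vertexIndex σ 2 0, vertexIndex σ 1 1, vertexIndex σ 3 0,
    vertexIndex σ 2 1, quarterIndex σ, midIndex σ]

/-- The coefficients `(a, b)` in the derivative `a * q * max ℓ 0 ^ n + b * max ℓ 0 ^ (n + 1)` of a
truncated power `q * max ℓ 0 ^ (n + k)` in `k` directions, where `t = (q, ℓ)`. -/
def truncDeriv (t : (Fin 3 → ℚ) × (Fin 3 → ℚ)) : ℕ → List (Fin 3 → ℚ) → ℚ × ℚ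
  | _, [] => (1, 0)
  | n, d :: ds =>
    let s := truncDeriv t (n + 1) ds
    ((n + 1) * (t.2 ⬝ᵥ d) * s.1, (t.1 ⬝ᵥ d) * s.1 + (n + 2) * (t.2 ⬝ᵥ d) * s.2)

theorem truncDeriv_perm (t : (Fin 3 → ℚ) × (Fin 3 → ℚ)) {ds ds' : List (Fin 3 → ℚ)}
    (h : ds.Perm ds') (n : ℕ) : truncDeriv t n ds = truncDeriv t n ds' := by
  induction h generalizing n with
  | nil => rfl
  | cons d _ ih => simp only [truncDeriv, ih]
  | swap d d' ds =>
    simp only [truncDeriv]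
    ext <;> push_cast <;> ring
  | trans _ _ ih ih' => rw [ih, ih']

/-- The derivative in the directions `ds` of the sum of the truncated powers
`q * max ℓ 0 ^ (n + ds.length)`, at the point with barycentric coordinates `p`. -/
def truncValue (L : List ((Fin 3 → ℚ) × (Fin 3 → ℚ))) (n : ℕ) (ds : List (Fin 3 → ℚ))
    (p : Fin 3 → ℚ) : ℚ :=
  (L.map fun t => (truncDeriv t n ds).1 * (t.1 ⬝ᵥ p) * max (t.2 ⬝ᵥ p) 0 ^ n +
    (truncDeriv t n ds).2 * max (t.2 ⬝ᵥ p) 0 ^ (n + 1)).sum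

theorem truncValue_truncTerms (F : Fin 8) (μ : NodalIndex) :
    truncValue (truncTerms F) (4 - μ.directions.length) μ.directions μ.point =
      if μ = formulaIndex 1 F then (formulaScale F : ℚ) else 0 := by
  revert F μ
  decide +kernel

theorem exists_relabel (σ : Equiv.Perm (Fin 3)) (μ : NodalIndex) : ∃ μ' : NodalIndex,
    μ'.point = μ.point ∘ σ ∧ μ'.directions.Perm (μ.directions.map (· ∘ σ)) ∧
      ∀ F, μ' = formulaIndex 1 F ↔ μ = formulaIndex σ F := by
  revert σ μ
  decide +kernel

theorem macroTriangle_comp_perm (v : Fin 3 → Plane) (σ : Equiv.Perm (Fin 3)) :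
    macroTriangle (v ∘ σ) = macroTriangle v := by
  rw [macroTriangle, σ.surjective.range_comp, macroTriangle]

theorem combo_comp_perm (v : Fin 3 → Plane) (σ : Equiv.Perm (Fin 3)) (w : Fin 3 → ℚ) :
    combo (v ∘ σ) (w ∘ σ) = combo v w :=
  Equiv.sum_comp σ fun k => (w k : ℝ) • v k

/-- The iterated derivative on the macrotriangle in the directions with barycentric coordinates
`ds`. -/
noncomputable def iteratedDirDeriv (v : Fin 3 → Plane) (ds : List (Fin 3 → ℚ)) (g : Plane → ℝ) :
    Plane → ℝ :=
  ds.foldr (fun d => dirDeriv v (combo v d)) g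

theorem iteratedDirDeriv_comp_perm (v : Fin 3 → Plane) (σ : Equiv.Perm (Fin 3))
    (ds : List (Fin 3 → ℚ)) (g : Plane → ℝ) :
    iteratedDirDeriv (v ∘ σ) (ds.map (· ∘ σ)) g = iteratedDirDeriv v ds g := by
  have hdir : dirDeriv (v ∘ σ) = dirDeriv v := by
    funext u g x
    rw [dirDeriv, macroTriangle_comp_perm, dirDeriv]
  simp only [iteratedDirDeriv, List.foldr_map, hdir, combo_comp_perm]

theorem combo_single (v : Fin 3 → Plane) (k : Fin 3) (c : ℚ) :
    combo v (Pi.single k c) = (c : ℝ) • v k := by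
  rw [combo, Finset.sum_eq_single k]
  · simp
  · intro i _ hi
    simp [hi]
  · simp

theorem combo_add (v : Fin 3 → Plane) (w w' : Fin 3 → ℚ) :
    combo v (w + w') = combo v w + combo v w' := by
  simp [combo, add_smul, Finset.sum_add_distrib]

theorem combo_sub (v : Fin 3 → Plane) (w w' : Fin 3 → ℚ) :
    combo v (w - w') = combo v w - combo v w' := by
  simp [combo, sub_smul, Finset.sum_sub_distrib]

theorem iteratedDirDeriv_replicate (v : Fin 3 → Plane) (n : ℕ) (d : Fin 3 → ℚ) (g : Plane → ℝ) :
    iteratedDirDeriv v (List.replicate n d) g = (dirDeriv v (combo v d))^[n] g := by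
  induction n with
  | zero => rfl
  | succ n ih =>
    rw [Function.iterate_succ_apply', ← ih]
    rfl

theorem nodalFunctional_eq_iteratedDirDeriv (v : Fin 3 → Plane) (μ : NodalIndex)
    (g : Plane → ℝ) :
    nodalFunctional v μ g = iteratedDirDeriv v μ.directions g (combo v μ.point) := by
  have hcross : ∀ k, combo v (crossCoord k) = crossDir v k := fun k => by
    simp [crossCoord, combo_sub, combo_add, combo_single, crossDir]
  cases μ with
  | vertex k i j h =>
    have happend : ∀ ds ds', iteratedDirDeriv v (ds ++ ds') g =
        iteratedDirDeriv v ds (iteratedDirDeriv v ds' g) := fun _ _ => List.foldr_append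
    simp [NodalIndex.directions, NodalIndex.point, nodalFunctional, happend,
      iteratedDirDeriv_replicate, combo_sub, combo_single]
  | _ k =>
    simp only [nodalFunctional, NodalIndex.directions, NodalIndex.point, iteratedDirDeriv,
      List.foldr_cons, List.foldr_nil, hcross, combo_add, combo_single, Function.iterate_succ_apply,
      Function.iterate_zero_apply]
    congr 1
    push_cast
    module

section

variable (T : AffineBasis (Fin 3) ℝ Plane)

/-- The sum of the functions `a * q * max ℓ 0 ^ n + b * max ℓ 0 ^ (n + 1)` with the coefficients of
`truncDeriv`. -/
noncomputable def truncDerivSum (L : List ((Fin 3 → ℚ) × (Fin 3 → ℚ))) (n : ℕ)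
    (ds : List (Fin 3 → ℚ)) (x : Plane) : ℝ :=
  (L.map fun t => (truncDeriv t n ds).1 * affineForm T t.1 x * max (affineForm T t.2 x) 0 ^ n +
    (truncDeriv t n ds).2 * max (affineForm T t.2 x) 0 ^ (n + 1)).sum

theorem truncDerivSum_nil (L : List ((Fin 3 → ℚ) × (Fin 3 → ℚ))) (n : ℕ) :
    truncDerivSum T L n [] = truncSum T n L := by
  funext x
  simp [truncDerivSum, truncSum, truncDeriv]

theorem truncDerivSum_combo (L : List ((Fin 3 → ℚ) × (Fin 3 → ℚ))) (n : ℕ)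
    (ds : List (Fin 3 → ℚ)) {p : Fin 3 → ℚ} (hp : ∑ i, p i = 1) :
    truncDerivSum T L n ds (combo T p) = truncValue L n ds p := by
  rw [truncDerivSum, truncValue, Rat.cast_list_sum, List.map_map]
  congr 2
  funext t
  simp [affineForm_combo T _ hp]

theorem hasFDerivAt_truncPair (q ℓ : Plane →ᵃ[ℝ] ℝ) (a b : ℝ) (n : ℕ) (x : Plane) :
    ∃ D : Plane →L[ℝ] ℝ, HasFDerivAt
      (fun y => a * q y * max (ℓ y) 0 ^ (n + 2) + b * max (ℓ y) 0 ^ (n + 3)) D x ∧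
      ∀ u, D u = (n + 2) * ℓ.linear u * a * q x * max (ℓ x) 0 ^ (n + 1) +
        (q.linear u * a + (n + 3) * ℓ.linear u * b) * max (ℓ x) 0 ^ (n + 2) := by
  have hq := (hasFDerivAt_affineMap q x).const_mul a
  have hℓ := hasFDerivAt_affineMap ℓ x
  have hpow := fun n => (hasDerivAt_max_zero_pow n (ℓ x)).comp_hasFDerivAt x hℓ
  refine ⟨_, (hq.mul (hpow n)).add ((hpow (n + 1)).const_mul b), fun u => ?_⟩
  simp only [add_apply, smul_apply, LinearMap.coe_toContinuousLinearMap', Function.comp_apply,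
    smul_eq_mul]
  push_cast
  ring

theorem hasFDerivAt_truncDerivSum (L : List ((Fin 3 → ℚ) × (Fin 3 → ℚ))) (n : ℕ)
    (ds : List (Fin 3 → ℚ)) (x : Plane) :
    ∃ D : Plane →L[ℝ] ℝ, HasFDerivAt (truncDerivSum T L (n + 2) ds) D x ∧
      ∀ d : Fin 3 → ℚ, ∑ i, d i = 0 →
        D (combo T d) = truncDerivSum T L (n + 1) (d :: ds) x := by
  choose D hD hval using fun t : (Fin 3 → ℚ) × (Fin 3 → ℚ) =>
    hasFDerivAt_truncPair (affineForm T t.1) (affineForm T t.2) (truncDeriv t (n + 2) ds).1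
      (truncDeriv t (n + 2) ds).2 n x
  induction L with
  | nil => exact ⟨0, hasFDerivAt_const 0 x, fun d _ => rfl⟩
  | cons t L ih =>
    obtain ⟨D', hD', hval'⟩ := ih
    refine ⟨D t + D', (hD t).add hD', fun d hd => ?_⟩
    rw [add_apply, hval, hval' d hd]
    simp only [truncDerivSum, List.map_cons, List.sum_cons, linear_affineForm_combo T _ hd]
    congr 1
    simp only [truncDeriv]
    push_cast
    ring

theorem iteratedDirDeriv_eq_truncDerivSum {L : List ((Fin 3 → ℚ) × (Fin 3 → ℚ))} {g : Plane → ℝ}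
    {c : ℝ} {ds : List (Fin 3 → ℚ)} (hds : ∀ d ∈ ds, ∑ i, d i = 0) (n : ℕ)
    (hg : ∀ x ∈ macroTriangle T, g x = truncSum T (n + 1 + ds.length) L x / c) :
    ∀ x ∈ macroTriangle T, iteratedDirDeriv T ds g x = truncDerivSum T L (n + 1) ds x / c := by
  induction ds generalizing n with
  | nil => simpa [iteratedDirDeriv, truncDerivSum_nil] using hg
  | cons d ds ih =>
    intro x hx
    rw [List.length_cons, ← add_assoc, add_right_comm _ _ 1] at hg
    have heq := ih (fun d' hd' => hds d' (List.mem_cons_of_mem _ hd')) (n + 1) hg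
    obtain ⟨D, hD, hval⟩ := hasFDerivAt_truncDerivSum T L n ds x
    have hderiv : HasFDerivWithinAt (iteratedDirDeriv T ds g) (c⁻¹ • D) (macroTriangle T) x :=
      (hD.hasFDerivWithinAt.const_mul c⁻¹).congr
        (fun y hy => (heq y hy).trans (div_eq_inv_mul _ _))
        ((heq x hx).trans (div_eq_inv_mul _ _))
    calc iteratedDirDeriv T (d :: ds) g x
        = fderivWithin ℝ (iteratedDirDeriv T ds g) (macroTriangle T) x (combo T d) := rfl
      _ = c⁻¹ * truncDerivSum T L (n + 1) (d :: ds) x := by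
        rw [hderiv.fderivWithin (uniqueDiffOn_macroTriangle T x hx), smul_apply,
          hval d (hds d List.mem_cons_self), smul_eq_mul]
      _ = truncDerivSum T L (n + 1) (d :: ds) x / c := (div_eq_inv_mul _ _).symm

theorem NodalIndex.sum_point (μ : NodalIndex) : ∑ i, μ.point i = 1 := by
  revert μ
  decide +kernel

theorem NodalIndex.point_nonneg (μ : NodalIndex) (i : Fin 3) : 0 ≤ μ.point i := by
  revert μ i
  decide +kernel

theorem NodalIndex.sum_eq_zero_of_mem_directions {μ : NodalIndex} {d : Fin 3 → ℚ}
    (hd : d ∈ μ.directions) : ∑ i, d i = 0 := by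
  have h : ∀ μ : NodalIndex, ∀ d ∈ μ.directions, ∑ i, d i = 0 := by decide +kernel
  exact h μ d hd

theorem NodalIndex.length_directions_le (μ : NodalIndex) : μ.directions.length ≤ 3 := by
  revert μ
  decide

theorem nodalFunctional_nodalSpline_one {cell : Plane → Set Plane} (hcell : IsFaceAssignment T cell)
    (F : Fin 8) (μ : NodalIndex) {ds : List (Fin 3 → ℚ)} (hds : ds.Perm μ.directions) :
    iteratedDirDeriv T ds (nodalSpline T cell F) (combo T μ.point) =
      if μ = formulaIndex 1 F then 1 else 0 := by
  have hlen : ds.length = μ.directions.length := hds.length_eq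
  have hle := μ.length_directions_le
  have hsum : ∀ d ∈ ds, ∑ i, d i = 0 := fun d hd =>
    NodalIndex.sum_eq_zero_of_mem_directions (hds.mem_iff.1 hd)
  have hspline : ∀ x ∈ macroTriangle T, nodalSpline T cell F x =
      truncSum T (3 - ds.length + 1 + ds.length) (truncTerms F) x / formulaScale F := by
    rw [show 3 - ds.length + 1 + ds.length = 4 by omega]
    exact fun x => nodalSpline_eq_truncSum hcell F
  have hvalue : truncValue (truncTerms F) (3 - ds.length + 1) ds μ.point =
      if μ = formulaIndex 1 F then (formulaScale F : ℚ) else 0 := by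
    rw [← truncValue_truncTerms F μ, show 3 - ds.length + 1 = 4 - μ.directions.length by omega]
    simp only [truncValue, truncDeriv_perm _ hds]
  have hscale : (formulaScale F : ℝ) ≠ 0 := by
    have h : ∀ F, formulaScale F ≠ 0 := by decide
    exact_mod_cast h F
  rw [iteratedDirDeriv_eq_truncDerivSum T hsum (3 - ds.length) hspline _
    (combo_mem_macroTriangle T μ.sum_point μ.point_nonneg),
    truncDerivSum_combo T _ _ _ μ.sum_point, hvalue]
  split_ifs
  · simp [hscale]
  · simp

end

/-! ### Relabelling the corners -/

theorem exists_face_perm (v : Fin 3 → Plane) (σ : Equiv.Perm (Fin 3)) (f : Fin 12) :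
    ∃ f', face v f = face (v ∘ σ) f' := by
  have h : ∀ (σ : Equiv.Perm (Fin 3)) (f : Fin 12), ∃ f' : Fin 12, ∀ k i,
      splitCoord (faceVertex f k) (σ i) = splitCoord (faceVertex f' k) i := by
    decide +kernel
  obtain ⟨f', h⟩ := h σ f
  refine ⟨f', ?_⟩
  have hpoint : ∀ k, splitPoint v (faceVertex f k) = splitPoint (v ∘ σ) (faceVertex f' k) :=
    fun k => by
      rw [splitPoint, ← Equiv.sum_comp σ, splitPoint]
      simp only [h k, Function.comp_apply]
  simp only [face, hpoint]

theorem IsFaceAssignment.comp_perm {v : Fin 3 → Plane} {cell : Plane → Set Plane}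
    (hcell : IsFaceAssignment v cell) (σ : Equiv.Perm (Fin 3)) :
    IsFaceAssignment (v ∘ σ) cell := by
  intro x hx
  rw [macroTriangle_comp_perm] at hx
  obtain ⟨hmem, f, hf⟩ := hcell x hx
  obtain ⟨f', hf'⟩ := exists_face_perm v σ f
  exact ⟨hmem, f', hf.trans hf'⟩

theorem splineSpace_comp_perm_le (v : Fin 3 → Plane) (σ : Equiv.Perm (Fin 3)) (r d : ℕ) :
    splineSpace (v ∘ σ) r d ≤ splineSpace v r d := by
  rintro g ⟨hzero, hsmooth, hpoly⟩
  rw [macroTriangle_comp_perm] at hzero hsmooth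
  refine ⟨hzero, hsmooth, fun f => ?_⟩
  obtain ⟨f', hf'⟩ := exists_face_perm v σ f
  rw [hf']
  exact hpoly f'

theorem nodalFunctional_nodalSpline (T : AffineBasis (Fin 3) ℝ Plane) {cell : Plane → Set Plane}
    (hcell : IsFaceAssignment T cell) (σ : Equiv.Perm (Fin 3)) (F : Fin 8) (μ : NodalIndex) :
    nodalFunctional T μ (nodalSpline (T ∘ σ) cell F) = if μ = formulaIndex σ F then 1 else 0 := by
  obtain ⟨μ', hpoint, hdirections, hindex⟩ := exists_relabel σ μ
  have hT : ⇑(T.reindex σ.symm) = T ∘ σ := rfl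
  rw [nodalFunctional_eq_iteratedDirDeriv, ← iteratedDirDeriv_comp_perm _ σ,
    ← combo_comp_perm _ σ, ← hpoint, ← hT]
  rw [nodalFunctional_nodalSpline_one (T.reindex σ.symm) (hcell.comp_perm σ) F μ' hdirections.symm]
  simp only [hindex]

theorem nodalSpline_comp_perm_mem_splineSpace (T : AffineBasis (Fin 3) ℝ Plane)
    {cell : Plane → Set Plane} (hcell : IsFaceAssignment T cell) (σ : Equiv.Perm (Fin 3))
    (F : Fin 8) : nodalSpline (T ∘ σ) cell F ∈ splineSpace T 3 5 :=
  splineSpace_comp_perm_le T σ 3 5 <|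
    nodalSpline_mem_splineSpace (T := T.reindex σ.symm) (hcell.comp_perm σ) F

/-! ### Bivariate polynomials vanishing to high order on a line -/

theorem iterate_derivation_mul {R A : Type*} [CommSemiring R] [CommSemiring A] [Algebra R A]
    (D : Derivation R A A) {a : A} {c : R} (ha : D a = algebraMap R A c) (b : A) (j : ℕ) :
    D^[j + 1] (a * b) = a * D^[j + 1] b + (j + 1) * algebraMap R A c * D^[j] b := by
  induction j with
  | zero => simp [ha, mul_comm]
  | succ j ih =>
    have hconst : D ((j + 1 : A) * algebraMap R A c) = 0 := by
      have : (j + 1 : A) * algebraMap R A c = algebraMap R A ((j + 1) * c) := by simp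
      rw [this, D.map_algebraMap]
    rw [Function.iterate_succ_apply', ih, map_add, D.leibniz, D.leibniz, hconst, ha,
      ← Function.iterate_succ_apply' D, ← Function.iterate_succ_apply' D]
    push_cast
    simp only [smul_eq_mul]
    ring

section

open MvPolynomial

/-- The derivative of a bivariate polynomial in the direction `u`. -/
noncomputable def polyDeriv (u : Plane) :
    Derivation ℝ (MvPolynomial (Fin 2) ℝ) (MvPolynomial (Fin 2) ℝ) :=
  mkDerivation ℝ fun k => C (u k)

theorem polyDeriv_affinePoly (u : Plane) (A : Plane →ᵃ[ℝ] ℝ) :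
    polyDeriv u (affinePoly A) = C (A.linear u) := by
  have hu := affineMap_apply_eq A.linear.toAffineMap u
  simp only [LinearMap.coe_toAffineMap, LinearMap.toAffineMap_linear, map_zero, add_zero] at hu
  rw [hu]
  simp [polyDeriv, affinePoly, Derivation.leibniz]

theorem hasFDerivAt_eval (p : MvPolynomial (Fin 2) ℝ) (x : Plane) :
    ∃ D : Plane →L[ℝ] ℝ, HasFDerivAt (fun y : Plane => eval (fun k => y k) p) D x ∧
      ∀ u, D u = eval (fun k => x k) (polyDeriv u p) := by
  induction p using MvPolynomial.induction_on with
  | C a => exact ⟨0, by simpa using hasFDerivAt_const a x, fun u => by simp [polyDeriv]⟩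
  | add p q hp hq =>
    obtain ⟨D, hD, hval⟩ := hp
    obtain ⟨D', hD', hval'⟩ := hq
    exact ⟨D + D', (hD.add hD').congr_of_eventuallyEq (.of_forall fun y => map_add _ _ _),
      fun u => by simp [hval, hval']⟩
  | mul_X p k hp =>
    obtain ⟨D, hD, hval⟩ := hp
    have hmul := hD.mul (EuclideanSpace.proj (𝕜 := ℝ) k).hasFDerivAt
    refine ⟨_, hmul.congr_of_eventuallyEq (.of_forall fun y => by simp), fun u => ?_⟩
    simp [hval, polyDeriv, Derivation.leibniz]

theorem exists_X_eq_add_affinePoly {ℓ : Plane →ᵃ[ℝ] ℝ} {P d : Plane} (hℓ : ℓ.linear ≠ 0)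
    (hP : ℓ P = 0) (hd : ℓ.linear d = 0) (hd0 : d ≠ 0) :
    ∃ (m : MvPolynomial (Fin 2) ℝ) (w : Plane), ∀ k,
      X k = C (P k) + C (d k) * m + C (w k) * affinePoly ℓ := by
  set a := ℓ.linear (EuclideanSpace.single 0 1) with ha
  set b := ℓ.linear (EuclideanSpace.single 1 1) with hb
  have hdir : ∀ v : Plane, ℓ.linear v = a * v 0 + b * v 1 := fun v => by
    simpa using affineMap_apply_eq ℓ.linear.toAffineMap v
  have hM : a ^ 2 + b ^ 2 ≠ 0 := fun h => hℓ <| LinearMap.ext fun v => by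
    have ha0 : a = 0 := by nlinarith
    have hb0 : b = 0 := by nlinarith
    simp [hdir, ha0, hb0]
  have hN : d 0 ^ 2 + d 1 ^ 2 ≠ 0 := fun h => hd0 <| by
    ext i
    fin_cases i
    · change d 0 = 0
      nlinarith
    · change d 1 = 0
      nlinarith
  rw [hdir] at hd
  rw [affineMap_apply_eq, ← ha, ← hb] at hP
  refine ⟨C (d 0 ^ 2 + d 1 ^ 2)⁻¹ * (C (d 0) * (X 0 - C (P 0)) + C (d 1) * (X 1 - C (P 1))),
    (a ^ 2 + b ^ 2)⁻¹ • !₂[a, b], fun k => MvPolynomial.funext fun x => ?_⟩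
  have hx := eval_affinePoly ℓ (WithLp.toLp 2 x)
  rw [affineMap_apply_eq, ← ha, ← hb] at hx
  simp only [map_add, map_mul, map_sub, eval_C, eval_X, hx]
  fin_cases k
  · simp only [Fin.zero_eta, PiLp.smul_apply, Matrix.cons_val_zero, smul_eq_mul]
    field_simp
    linear_combination ((x 0 - P 0) * (d 1 * b - a * d 0) - (x 1 - P 1) * (a * d 1 + b * d 0)) *
      hd - (d 0 ^ 2 + d 1 ^ 2) * a * hP
  · simp only [Fin.mk_one, PiLp.smul_apply, Matrix.cons_val_one, Matrix.cons_val_fin_one,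
      smul_eq_mul]
    field_simp
    linear_combination ((x 1 - P 1) * (a * d 0 - d 1 * b) - (x 0 - P 0) * (a * d 1 + b * d 0)) *
      hd - (d 0 ^ 2 + d 1 ^ 2) * b * hP

theorem affinePoly_dvd {ℓ : Plane →ᵃ[ℝ] ℝ} {P d : Plane} (hℓ : ℓ.linear ≠ 0) (hP : ℓ P = 0)
    (hd : ℓ.linear d = 0) (hd0 : d ≠ 0) {S : Set ℝ} (hS : S.Infinite)
    {q : MvPolynomial (Fin 2) ℝ} (hq : ∀ t ∈ S, eval (fun k => (P + t • d) k) q = 0) :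
    affinePoly ℓ ∣ q := by
  obtain ⟨m, w, hX⟩ := exists_X_eq_add_affinePoly hℓ hP hd hd0
  let φ : MvPolynomial (Fin 2) ℝ →ₐ[ℝ] Polynomial ℝ :=
    aeval fun k => Polynomial.C (P k) + Polynomial.C (d k) * Polynomial.X
  have hdvd : ∀ p, affinePoly ℓ ∣ p - Polynomial.aeval m (φ p) := fun p => by
    induction p using MvPolynomial.induction_on with
    | C a => simp [φ]
    | add p q hp hq =>
      rw [map_add, map_add, add_sub_add_comm]
      exact dvd_add hp hq
    | mul_X p k hp =>
      have hk : X k - Polynomial.aeval m (φ (X k)) = C (w k) * affinePoly ℓ := by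
        simp only [φ, aeval_X, map_add, map_mul, Polynomial.aeval_C, Polynomial.aeval_X,
          algebraMap_eq]
        linear_combination hX k
      have hsplit : p * X k - Polynomial.aeval m (φ (p * X k)) =
          (p - Polynomial.aeval m (φ p)) * Polynomial.aeval m (φ (X k)) +
            p * C (w k) * affinePoly ℓ := by
        rw [map_mul, map_mul]
        linear_combination p * hk
      rw [hsplit]
      exact dvd_add (hp.mul_right _) (dvd_mul_left _ _)
  have hφ : φ q = 0 := by
    refine Polynomial.eq_zero_of_infinite_isRoot _ (hS.mono fun t ht => ?_)
    have heval : (Polynomial.aeval t).comp φ = aeval fun k => (P + t • d) k := by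
      ext k
      simp only [φ, AlgHom.comp_apply, aeval_X, map_add, map_mul, Polynomial.aeval_C,
        Polynomial.aeval_X, PiLp.add_apply, PiLp.smul_apply, smul_eq_mul, mul_comm t]
      rfl
    have happly := DFunLike.congr_fun heval q
    rwa [AlgHom.comp_apply, aeval_eq_eval, hq t ht, Polynomial.coe_aeval_eq_eval] at happly
  simpa [hφ] using hdvd q

theorem affinePoly_pow_dvd {ℓ : Plane →ᵃ[ℝ] ℝ} {P d u : Plane} (hℓ : ℓ.linear u ≠ 0)
    (hP : ℓ P = 0) (hd : ℓ.linear d = 0) (hd0 : d ≠ 0) {S : Set ℝ} (hS : S.Infinite) (m : ℕ)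
    {q : MvPolynomial (Fin 2) ℝ}
    (hq : ∀ j < m, ∀ t ∈ S, eval (fun k => (P + t • d) k) ((polyDeriv u)^[j] q) = 0) :
    affinePoly ℓ ^ m ∣ q := by
  induction m generalizing q with
  | zero => simp
  | succ m ih =>
    obtain ⟨r, rfl⟩ := affinePoly_dvd (fun h => hℓ (by rw [h]; rfl)) hP hd hd0 hS
      (hq 0 m.succ_pos)
    rw [pow_succ']
    refine mul_dvd_mul_left _ (ih fun j hj t ht => ?_)
    have hzero : ℓ (P + t • d) = 0 := by
      have := ℓ.map_vadd P (t • d)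
      simpa [hP, hd, add_comm] using this
    have hderiv := hq (j + 1) (by omega) t ht
    rw [iterate_derivation_mul _ (polyDeriv_affinePoly u ℓ)] at hderiv
    have hcoeff : (j + 1 : ℝ) * ℓ.linear u ≠ 0 := mul_ne_zero (by positivity) hℓ
    have hprod : (j + 1 : ℝ) * ℓ.linear u *
        eval (fun k => (P + t • d) k) ((polyDeriv u)^[j] r) = 0 := by
      simpa only [map_add, map_mul, eval_affinePoly, hzero, zero_mul, zero_add, map_natCast,
        map_one, algebraMap_eq, eval_C] using hderiv
    exact (mul_eq_zero.1 hprod).resolve_left hcoeff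

end

/-! ### Derivatives of splines on the faces -/

section

open MvPolynomial

variable (T : AffineBasis (Fin 3) ℝ Plane)

/-- The iterated derivative of a bivariate polynomial in the directions with barycentric
coordinates `ds`. -/
noncomputable def iteratedPolyDeriv (ds : List (Fin 3 → ℚ)) :
    MvPolynomial (Fin 2) ℝ →ₗ[ℝ] MvPolynomial (Fin 2) ℝ :=
  (ds.map fun d => (polyDeriv (combo T d)).toLinearMap).prod

variable {T}

theorem contDiffOn_iteratedDirDeriv {n : ℕ} {ds : List (Fin 3 → ℚ)} {g : Plane → ℝ}
    (hg : ContDiffOn ℝ (n + ds.length : ℕ) g (macroTriangle T)) :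
    ContDiffOn ℝ n (iteratedDirDeriv T ds g) (macroTriangle T) := by
  induction ds generalizing n with
  | nil => exact hg
  | cons d ds ih =>
    rw [List.length_cons, ← add_assoc, add_right_comm] at hg
    exact ((ih hg).fderivWithin (uniqueDiffOn_macroTriangle T) (by norm_cast)).clm_apply
      contDiffOn_const

theorem iteratedDirDeriv_eq_eval {g : Plane → ℝ} {p : MvPolynomial (Fin 2) ℝ} {f : Fin 12}
    (hp : ∀ x ∈ face T f, g x = eval (fun k => x k) p) {ds : List (Fin 3 → ℚ)}
    (hg : ContDiffOn ℝ ds.length g (macroTriangle T)) :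
    ∀ x ∈ face T f, iteratedDirDeriv T ds g x = eval (fun k => x k) (iteratedPolyDeriv T ds p) := by
  induction ds with
  | nil => exact hp
  | cons d ds ih =>
    intro x hx
    have heq := ih (hg.of_le (by simp))
    have hdiff : DifferentiableOn ℝ (iteratedDirDeriv T ds g) (macroTriangle T) :=
      (contDiffOn_iteratedDirDeriv (n := 1) (by rwa [add_comm])).differentiableOn (by simp)
    have hface := (hdiff x (face_subset_macroTriangle T f hx)).hasFDerivWithinAt.mono
      (face_subset_macroTriangle T f)
    obtain ⟨D, hD, hval⟩ := hasFDerivAt_eval (iteratedPolyDeriv T ds p) x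
    have hpoly := hD.hasFDerivWithinAt.congr (s := face T f) heq (heq x hx)
    calc iteratedDirDeriv T (d :: ds) g x
        = fderivWithin ℝ (iteratedDirDeriv T ds g) (macroTriangle T) x (combo T d) := rfl
      _ = D (combo T d) := by rw [(uniqueDiffOn_face T f x hx).eq hface hpoly]
      _ = eval (fun k => x k) (iteratedPolyDeriv T (d :: ds) p) := hval _

theorem nodalFunctional_eq_eval {s : Plane → ℝ} (hs : ContDiffOn ℝ 3 s (macroTriangle T))
    {f : Fin 12} {p : MvPolynomial (Fin 2) ℝ} (hp : ∀ x ∈ face T f, s x = eval (fun k => x k) p)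
    {μ : NodalIndex} (hμ : combo T μ.point ∈ face T f) :
    nodalFunctional T μ s =
      eval (fun k => combo T μ.point k) (iteratedPolyDeriv T μ.directions p) := by
  rw [nodalFunctional_eq_iteratedDirDeriv]
  exact iteratedDirDeriv_eq_eval hp
    (hs.of_le (by exact_mod_cast μ.length_directions_le)) _ hμ

variable (T)

/-- The functional `nodalFunctional T μ` as an element of the dual of the spline space. -/
noncomputable def nodalDual (μ : NodalIndex) : Module.Dual ℝ (splineSpace T 3 5) where
  toFun s := nodalFunctional T μ s
  map_add' := by
    rintro ⟨s, -, hs, hs'⟩ ⟨t, -, ht, ht'⟩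
    obtain ⟨f, hf⟩ := exists_mem_face (combo_mem_macroTriangle T μ.sum_point μ.point_nonneg)
    obtain ⟨p, -, hp⟩ := hs' f
    obtain ⟨q, -, hq⟩ := ht' f
    have hpq : ∀ x ∈ face T f, (s + t) x = eval (fun k => x k) (p + q) := fun x hx => by
      simp [hp x hx, hq x hx]
    rw [nodalFunctional_eq_eval hs hp hf, nodalFunctional_eq_eval ht hq hf]
    exact (nodalFunctional_eq_eval (hs.add ht) hpq hf).trans (by simp)
  map_smul' := by
    rintro c ⟨s, -, hs, hs'⟩
    obtain ⟨f, hf⟩ := exists_mem_face (combo_mem_macroTriangle T μ.sum_point μ.point_nonneg)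
    obtain ⟨p, -, hp⟩ := hs' f
    have hcp : ∀ x ∈ face T f, (c • s) x = eval (fun k => x k) (c • p) := fun x hx => by
      simp [hp x hx, smul_eval]
    rw [nodalFunctional_eq_eval hs hp hf]
    exact (nodalFunctional_eq_eval (contDiffOn_const.smul hs) hcp hf).trans (by simp [smul_eval])

end

/-! ### The difference of two neighbouring pieces of a spline -/

section

open MvPolynomial

theorem exists_affineMap_eq_eval {p : MvPolynomial (Fin 2) ℝ} (hp : p.totalDegree ≤ 1) :
    ∃ A : Plane →ᵃ[ℝ] ℝ, ∀ x : Plane, eval (fun k => x k) p = A x := by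
  have hmonomial : ∀ m ∈ p.support, ∃ A : Plane →ᵃ[ℝ] ℝ, ∀ x : Plane,
      eval (fun k => x k) (monomial m (coeff m p)) = A x := by
    intro m hm
    have hdeg : m.degree ≤ 1 := (le_totalDegree hm).trans hp
    obtain h | h : m.degree = 0 ∨ m.degree = 1 := by omega
    · obtain rfl := (Finsupp.degree_eq_zero_iff m).1 h
      exact ⟨AffineMap.const ℝ _ (coeff 0 p), by simp⟩
    · obtain ⟨i, rfl⟩ := (Finsupp.sum_eq_one_iff m).1 h
      exact ⟨coeff (Finsupp.single i 1) p •
        (EuclideanSpace.proj (𝕜 := ℝ) i).toLinearMap.toAffineMap, fun x => by simp [eval_monomial]⟩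
  choose! A hA using hmonomial
  refine ⟨∑ m ∈ p.support, A m, fun x => ?_⟩
  let evalAt : (Plane →ᵃ[ℝ] ℝ) →+ ℝ := ⟨⟨fun B => B x, rfl⟩, fun _ _ => rfl⟩
  conv_lhs => rw [as_sum p, map_sum, Finset.sum_congr rfl fun m hm => hA m hm x]
  exact (map_sum evalAt A p.support).symm

theorem totalDegree_affinePoly {ℓ : Plane →ᵃ[ℝ] ℝ} (hℓ : ℓ.linear ≠ 0) :
    (affinePoly ℓ).totalDegree = 1 := by
  refine le_antisymm (totalDegree_affinePoly_le ℓ) (Nat.one_le_iff_ne_zero.2 fun h => hℓ ?_)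
  ext u
  have hderiv := polyDeriv_affinePoly u ℓ
  rw [totalDegree_eq_zero_iff_eq_C.1 h, polyDeriv, derivation_C] at hderiv
  simpa using hderiv.symm

theorem totalDegree_affinePoly_pow {ℓ : Plane →ᵃ[ℝ] ℝ} (hℓ : ℓ.linear ≠ 0) (n : ℕ) :
    (affinePoly ℓ ^ n).totalDegree = n := by
  have hne : affinePoly ℓ ≠ 0 := fun h => by simpa [h] using totalDegree_affinePoly hℓ
  induction n with
  | zero => simp
  | succ n ih =>
    rw [pow_succ, totalDegree_mul_of_isDomain (pow_ne_zero n hne) hne, ih,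
      totalDegree_affinePoly hℓ]

theorem exists_affineMap_mul_pow_eq_eval {ℓ : Plane →ᵃ[ℝ] ℝ} (hℓ : ℓ.linear ≠ 0) {n : ℕ}
    {q : MvPolynomial (Fin 2) ℝ} (hq : q.totalDegree ≤ n + 1) (hdvd : affinePoly ℓ ^ n ∣ q) :
    ∃ A : Plane →ᵃ[ℝ] ℝ, ∀ x : Plane, eval (fun k => x k) q = A x * ℓ x ^ n := by
  obtain ⟨r, rfl⟩ := hdvd
  have hr : r.totalDegree ≤ 1 := by
    rcases eq_or_ne r 0 with rfl | hr
    · simp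
    · have hne : affinePoly ℓ ≠ 0 := fun h => by simpa [h] using totalDegree_affinePoly hℓ
      rw [totalDegree_mul_of_isDomain (pow_ne_zero n hne) hr, totalDegree_affinePoly_pow hℓ] at hq
      omega
  obtain ⟨A, hA⟩ := exists_affineMap_eq_eval hr
  exact ⟨A, fun x => by rw [map_mul, map_pow, eval_affinePoly, hA, mul_comm]⟩

/-- `P` and `Q` are distinct common vertices of the faces `f` and `g` on the line where the
barycentric coordinates satisfy the equation `c`. -/
def IsCommonEdge (f g : Fin 12) (P Q : Fin 10) (c : Fin 3 → ℤ) : Prop :=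
  P ≠ Q ∧ (∀ j ∈ [P, Q], castForm c ⬝ᵥ splitCoord j = 0 ∧
    (∃ k, faceVertex f k = j) ∧ ∃ k, faceVertex g k = j)

instance (f g : Fin 12) (P Q : Fin 10) (c : Fin 3 → ℤ) : Decidable (IsCommonEdge f g P Q c) :=
  inferInstanceAs (Decidable (_ ∧ _))

variable {T : AffineBasis (Fin 3) ℝ Plane}

theorem combo_ne_zero {d : Fin 3 → ℚ} (hd : ∑ i, d i = 0) (hd0 : d ≠ 0) : combo T d ≠ 0 := by
  obtain ⟨i, hi⟩ := Function.ne_iff.1 hd0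
  intro h
  have hlinear := linear_affineForm_combo T (Pi.single i 1) hd
  rw [h, map_zero, single_one_dotProduct] at hlinear
  exact hi (by exact_mod_cast hlinear.symm)

theorem iteratedPolyDeriv_replicate (m : ℕ) (d : Fin 3 → ℚ) (q : MvPolynomial (Fin 2) ℝ) :
    iteratedPolyDeriv T (List.replicate m d) q = (polyDeriv (combo T d))^[m] q := by
  rw [iteratedPolyDeriv, List.map_replicate, List.prod_replicate, Module.End.pow_apply]
  rfl

theorem splitCoord_injective : Function.Injective splitCoord := by
  decide +kernel

theorem eval_iterate_polyDeriv_sub_eq_zero {s : Plane → ℝ}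
    (hs : ContDiffOn ℝ 3 s (macroTriangle T)) {p q : MvPolynomial (Fin 2) ℝ} {f g : Fin 12}
    (hp : ∀ x ∈ face T f, s x = eval (fun k => x k) p)
    (hq : ∀ x ∈ face T g, s x = eval (fun k => x k) q) {x : Plane} (hf : x ∈ face T f)
    (hg : x ∈ face T g) {m : ℕ} (hm : m ≤ 3) (u : Fin 3 → ℚ) :
    eval (fun k => x k) ((polyDeriv (combo T u))^[m] (p - q)) = 0 := by
  have hsm : ContDiffOn ℝ (List.replicate m u).length s (macroTriangle T) :=
    hs.of_le (by rw [List.length_replicate]; exact_mod_cast hm)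
  rw [← iteratedPolyDeriv_replicate, map_sub, map_sub, ← iteratedDirDeriv_eq_eval hp hsm x hf,
    ← iteratedDirDeriv_eq_eval hq hsm x hg, sub_self]

theorem exists_linear_affineForm_combo_ne_zero {c : Fin 3 → ℤ} (hc : ∃ i j, c i ≠ c j) :
    ∃ u : Fin 3 → ℚ, (affineForm T (castForm c)).linear (combo T u) ≠ 0 := by
  obtain ⟨i, j, hij⟩ := hc
  refine ⟨Pi.single i 1 - Pi.single j 1, ?_⟩
  rw [linear_affineForm_combo T _ (by simp)]
  simpa [castForm, sub_eq_zero] using hij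

theorem exists_eval_eq_add_mul_pow {s : Plane → ℝ} (hs : ContDiffOn ℝ 3 s (macroTriangle T))
    {p : Fin 12 → MvPolynomial (Fin 2) ℝ} (hdeg : ∀ f, (p f).totalDegree ≤ 5)
    (hp : ∀ f, ∀ x ∈ face T f, s x = eval (fun k => x k) (p f)) {f g : Fin 12} {P Q : Fin 10}
    {c : Fin 3 → ℤ} (hPQ : IsCommonEdge f g P Q c) (hc : ∃ i j, c i ≠ c j) :
    ∃ A : Plane →ᵃ[ℝ] ℝ, ∀ x : Plane, eval (fun k => x k) (p f) =
      eval (fun k => x k) (p g) + A x * affineForm T (castForm c) x ^ 4 := by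
  obtain ⟨hne, hcommon⟩ := hPQ
  obtain ⟨⟨hcP, ⟨k₁, hfP⟩, ⟨k₂, hgP⟩⟩, ⟨hcQ, ⟨k₃, hfQ⟩, ⟨k₄, hgQ⟩⟩⟩ :=
    And.intro (hcommon P (by simp)) (hcommon Q (by simp))
  obtain ⟨u, hcu⟩ := exists_linear_affineForm_combo_ne_zero (T := T) hc
  set d : Fin 3 → ℚ := splitCoord Q - splitCoord P with hd
  have hdsum : ∑ k, d k = 0 := by simp [hd, sum_splitCoord]
  have hd0 : combo T d ≠ 0 :=
    combo_ne_zero hdsum (sub_ne_zero.2 fun h => hne (splitCoord_injective h).symm)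
  have hcd : (affineForm T (castForm c)).linear (combo T d) = 0 := by
    rw [linear_affineForm_combo T _ hdsum, hd, dotProduct_sub, hcP, hcQ]
    simp
  have hcP' : affineForm T (castForm c) (splitPoint T P) = 0 :=
    (affineForm_combo T (castForm c) (sum_splitCoord P)).trans (by simp [hcP])
  have hedge : ∀ h k k', faceVertex h k = P → faceVertex h k' = Q →
      ∀ t ∈ Set.Icc (0 : ℝ) 1, splitPoint T P + t • combo T d ∈ face T h := by
    rintro h k k' rfl rfl t ht
    rw [hd, combo_sub]
    exact (convex_convexHull ℝ _).add_smul_sub_mem (splitPoint_mem_face T h k)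
      (splitPoint_mem_face T h k') ht
  have hvanish : ∀ m < 4, ∀ t ∈ Set.Icc (0 : ℝ) 1,
      eval (fun k => (splitPoint T P + t • combo T d) k)
        ((polyDeriv (combo T u))^[m] (p f - p g)) = 0 := fun m hm t ht =>
    eval_iterate_polyDeriv_sub_eq_zero hs (hp f) (hp g) (hedge f k₁ k₃ hfP hfQ t ht)
      (hedge g k₂ k₄ hgP hgQ t ht) (Nat.lt_succ_iff.1 hm) u
  obtain ⟨A, hA⟩ := exists_affineMap_mul_pow_eq_eval (q := p f - p g)
    (fun h => hcu (by rw [h]; rfl)) ((totalDegree_sub _ _).trans (max_le (hdeg f) (hdeg g)))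
    (affinePoly_pow_dvd hcu hcP' hcd hd0 (Set.Icc_infinite one_pos) 4 hvanish)
  exact ⟨A, fun x => by rw [← hA, map_sub]; ring⟩

end

/-! ### Conformality at the interior vertices -/

theorem eq_zero_of_mul_pow_four_add_eq_zero {A B C : ℝ × ℝ →ᵃ[ℝ] ℝ}
    (h : ∀ a b : ℝ, A (a, b) * a ^ 4 + B (a, b) * b ^ 4 + C (a, b) * (b - a) ^ 4 = 0) :
    A = 0 ∧ B = 0 ∧ C = 0 := by
  have expand : ∀ D : ℝ × ℝ →ᵃ[ℝ] ℝ, ∃ α β γ : ℝ, ∀ a b, D (a, b) = α * a + β * b + γ := by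
    intro D
    refine ⟨D.linear (1, 0), D.linear (0, 1), D 0, fun a b => ?_⟩
    have hab : (a, b) = a • ((1, 0) : ℝ × ℝ) + b • ((0, 1) : ℝ × ℝ) := by simp
    rw [D.decomp, Pi.add_apply, hab, map_add, map_smul, map_smul, smul_eq_mul, smul_eq_mul,
      mul_comm a, mul_comm b]
    simp
  obtain ⟨α, α', α'', hA⟩ := expand A
  obtain ⟨β, β', β'', hB⟩ := expand B
  obtain ⟨γ, γ', γ'', hC⟩ := expand C
  have eq_zero : ∀ {D : ℝ × ℝ →ᵃ[ℝ] ℝ} {δ δ' δ'' : ℝ}, (∀ a b, D (a, b) = δ * a + δ' * b + δ'') →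
      δ = 0 → δ' = 0 → δ'' = 0 → D = 0 := by
    rintro D _ _ _ hD rfl rfl rfl
    ext ⟨a, b⟩
    simp [hD]
  simp only [hA, hB, hC] at h
  have h₁ := h 1 0
  have h₂ := h (-1) 0
  have h₃ := h 0 1
  have h₄ := h 0 (-1)
  have h₅ := h 1 1
  have h₆ := h (-1) (-1)
  have h₇ := h 1 (-1)
  have h₈ := h (-1) 1
  have h₉ := h 1 2
  have h₁₀ := h 2 1
  norm_num at h₁ h₂ h₃ h₄ h₅ h₆ h₇ h₈ h₉ h₁₀
  refine ⟨eq_zero hA ?_ ?_ ?_, eq_zero hB ?_ ?_ ?_, eq_zero hC ?_ ?_ ?_⟩ <;> linarith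

variable {s t A B C A' B' C' : Plane →ᵃ[ℝ] ℝ}

theorem eq_of_three_lines (hst : Function.Bijective (s.prod t))
    (h : ∀ x, A x * s x ^ 4 + B x * t x ^ 4 + C x * (t x - s x) ^ 4 =
      A' x * s x ^ 4 + B' x * t x ^ 4 + C' x * (t x - s x) ^ 4) :
    A = A' ∧ B = B' ∧ C = C' := by
  set E : Plane ≃ᵃ[ℝ] ℝ × ℝ := AffineEquiv.ofBijective hst
  have hE : ∀ a b, s (E.symm (a, b)) = a ∧ t (E.symm (a, b)) = b := fun a b =>
    Prod.ext_iff.1 (E.apply_symm_apply (a, b))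
  have hcancel : ∀ {D D' : Plane →ᵃ[ℝ] ℝ}, (D - D').comp E.symm.toAffineMap = 0 → D = D' := by
    intro D D' hD
    ext x
    have hx := DFunLike.congr_fun hD (E x)
    simpa [sub_eq_zero] using hx
  have hzero := eq_zero_of_mul_pow_four_add_eq_zero (A := (A - A').comp E.symm.toAffineMap)
    (B := (B - B').comp E.symm.toAffineMap) (C := (C - C').comp E.symm.toAffineMap) fun a b => by
      have hab := h (E.symm (a, b))
      rw [(hE a b).1, (hE a b).2] at hab
      simp only [AffineMap.comp_apply, AffineMap.coe_sub, Pi.sub_apply,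
        AffineEquiv.coe_toAffineMap]
      linarith
  exact ⟨hcancel hzero.1, hcancel hzero.2.1, hcancel hzero.2.2⟩

theorem eq_of_two_lines (hst : Function.Bijective (s.prod t))
    (h : ∀ x, A x * s x ^ 4 + B x * t x ^ 4 = A' x * s x ^ 4 + B' x * t x ^ 4) :
    A = A' ∧ B = B' := by
  have h' := eq_of_three_lines hst (C := 0) (C' := 0) (by simpa using h)
  exact ⟨h'.1, h'.2.1⟩

theorem bijective_affineForm_prod (T : AffineBasis (Fin 3) ℝ Plane) {c d : Fin 3 → ℚ}
    (hcd : (Matrix.of ![1, c, d]).det ≠ 0) :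
    Function.Bijective ((affineForm T c).prod (affineForm T d)) := by
  have hsurj : Function.Surjective ((affineForm T c).prod (affineForm T d)) := by
    rintro ⟨a, b⟩
    set M : Matrix (Fin 3) (Fin 3) ℝ := (Matrix.of ![1, c, d]).map ((↑) : ℚ → ℝ) with hM
    have hdet : IsUnit M.det := by
      rw [hM, ← Rat.coe_castHom, ← RingHom.mapMatrix_apply, ← RingHom.map_det]
      simpa using hcd
    set w : Fin 3 → ℝ := M⁻¹.mulVec ![1, a, b]
    have hw : M.mulVec w = ![1, a, b] := by
      rw [Matrix.mulVec_mulVec, Matrix.mul_nonsing_inv M hdet, Matrix.one_mulVec]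
    have hsum : ∑ i, w i = 1 := by
      simpa [hM, Matrix.mulVec, dotProduct] using congrFun hw 0
    have hcoord : ∀ i, T.coord i (Finset.univ.affineCombination ℝ T w) = w i := fun i =>
      T.coord_apply_combination_of_mem (Finset.mem_univ i) hsum
    refine ⟨Finset.univ.affineCombination ℝ T w, Prod.ext ?_ ?_⟩
    · simp only [AffineMap.prod_apply, affineForm_apply, hcoord]
      exact congrFun hw 1
    · simp only [AffineMap.prod_apply, affineForm_apply, hcoord]
      exact congrFun hw 2
  refine ⟨?_, hsurj⟩
  rw [← AffineMap.linear_injective_iff, LinearMap.injective_iff_surjective_of_finrank_eq_finrank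
    (by simp), AffineMap.linear_surjective_iff]
  exact hsurj

section

open MvPolynomial

/-- The equations of the six lines that support the interior edges of the 12-split: the three
medians, followed by the lines through two midpoints parallel to an edge. Each of them is
nonpositive on the first face. -/
def interiorForm : Fin 6 → Fin 3 → ℤ :=
  ![![0, -1, 1], ![-1, 0, 1], ![-1, 1, 0], ![-1, 1, 1], ![-1, 1, -1], ![-1, -1, 1]]

variable {T : AffineBasis (Fin 3) ℝ Plane}

theorem eq_of_parallel_pair (k : Fin 3) {A B A' B' : Plane →ᵃ[ℝ] ℝ}
    (h : ∀ x, A x * affineForm T (castForm (interiorForm (k.castAdd 3))) x ^ 4 +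
        B x * affineForm T (castForm (interiorForm (k.natAdd 3))) x ^ 4 =
      A' x * affineForm T (castForm (interiorForm (k.castAdd 3))) x ^ 4 +
        B' x * affineForm T (castForm (interiorForm (k.natAdd 3))) x ^ 4) :
    A = A' ∧ B = B' := by
  refine eq_of_two_lines (bijective_affineForm_prod T ?_) h
  clear h
  revert k
  decide +kernel

theorem eq_of_medians {A B C A' B' C' : Plane →ᵃ[ℝ] ℝ}
    (h : ∀ x, A x * affineForm T (castForm (interiorForm 0)) x ^ 4 +
        B x * affineForm T (castForm (interiorForm 1)) x ^ 4 +
        C x * affineForm T (castForm (interiorForm 2)) x ^ 4 =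
      A' x * affineForm T (castForm (interiorForm 0)) x ^ 4 +
        B' x * affineForm T (castForm (interiorForm 1)) x ^ 4 +
        C' x * affineForm T (castForm (interiorForm 2)) x ^ 4) :
    A = A' ∧ B = B' ∧ C = C' := by
  have hsub : ∀ x, affineForm T (castForm (interiorForm 2)) x =
      affineForm T (castForm (interiorForm 1)) x - affineForm T (castForm (interiorForm 0)) x := by
    intro x
    simp [affineForm_apply, castForm, interiorForm, Fin.sum_univ_three]
  simp only [hsub] at h
  exact eq_of_three_lines (bijective_affineForm_prod T (by decide +kernel)) h

theorem formNonneg_interiorForm (f : Fin 12) (k : Fin 6) :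
    FormNonneg f (interiorForm k) ↔ k ∈ (![∅, {0}, {2, 3, 4}, {1, 2, 3, 4}, {0, 1, 2, 3, 5},
      {0, 1, 3, 5}, {3}, {2, 3}, {1, 2, 3}, {0, 1, 2, 3}, {0, 1, 3}, {0, 3}] :
      Fin 12 → Finset (Fin 6)) f := by
  revert f k
  decide +kernel

theorem exists_cofactors {p : Fin 12 → Plane → ℝ}
    (hp : ∀ {f g P Q k}, IsCommonEdge f g P Q (interiorForm k) → ∃ A : Plane →ᵃ[ℝ] ℝ,
      ∀ x, p f x = p g x + A x * affineForm T (castForm (interiorForm k)) x ^ 4) :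
    ∃ A : Fin 6 → Plane →ᵃ[ℝ] ℝ, ∀ f x, p f x = p 0 x +
      ∑ k, if FormNonneg f (interiorForm k) then
        A k x * affineForm T (castForm (interiorForm k)) x ^ 4 else 0 := by
  have edge : ∀ f g P Q k, IsCommonEdge f g P Q (interiorForm k) → _ := fun _ _ _ _ _ => hp
  obtain ⟨A₀, h₀⟩ := edge 1 0 0 6 0 (by decide +kernel)
  obtain ⟨A₀', h₀'⟩ := edge 11 6 6 9 0 (by decide +kernel)
  obtain ⟨A₀'', h₀''⟩ := edge 9 8 4 9 0 (by decide +kernel)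
  obtain ⟨A₁, h₁⟩ := edge 3 2 1 7 1 (by decide +kernel)
  obtain ⟨A₁', h₁'⟩ := edge 8 7 7 9 1 (by decide +kernel)
  obtain ⟨A₁'', h₁''⟩ := edge 10 11 5 9 1 (by decide +kernel)
  obtain ⟨A₂, h₂⟩ := edge 4 5 2 8 2 (by decide +kernel)
  obtain ⟨A₂', h₂'⟩ := edge 9 10 8 9 2 (by decide +kernel)
  obtain ⟨A₂'', h₂''⟩ := edge 7 6 3 9 2 (by decide +kernel)
  obtain ⟨A₃, h₃⟩ := edge 6 0 3 6 3 (by decide +kernel)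
  obtain ⟨A₃', h₃'⟩ := edge 11 1 5 6 3 (by decide +kernel)
  obtain ⟨A₄, h₄⟩ := edge 2 7 3 7 4 (by decide +kernel)
  obtain ⟨A₄', h₄'⟩ := edge 3 8 4 7 4 (by decide +kernel)
  obtain ⟨A₅, h₅⟩ := edge 4 9 4 8 5 (by decide +kernel)
  obtain ⟨A₅', h₅'⟩ := edge 5 10 5 8 5 (by decide +kernel)
  -- The jumps add up to zero around each of the vertices `v₇`, `v₈`, `v₉`, `v₁₀`.
  obtain ⟨rfl, rfl⟩ : A₀ = A₀' ∧ A₃' = A₃ := eq_of_parallel_pair (T := T) 0 fun x => by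
    simp only [Fin.reduceCastAdd, Fin.reduceNatAdd]
    linarith [h₀ x, h₀' x, h₃ x, h₃' x]
  obtain ⟨rfl, rfl⟩ : A₁ = A₁' ∧ A₄ = A₄' := eq_of_parallel_pair (T := T) 1 fun x => by
    simp only [Fin.reduceCastAdd, Fin.reduceNatAdd]
    linarith [h₁ x, h₁' x, h₄ x, h₄' x]
  obtain ⟨rfl, rfl⟩ : A₂ = A₂' ∧ A₅' = A₅ := eq_of_parallel_pair (T := T) 2 fun x => by
    simp only [Fin.reduceCastAdd, Fin.reduceNatAdd]
    linarith [h₂ x, h₂' x, h₅ x, h₅' x]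
  obtain ⟨rfl, rfl, rfl⟩ : A₀ = A₀'' ∧ A₁'' = A₁ ∧ A₂ = A₂'' := eq_of_medians (T := T) fun x => by
    linarith [h₀' x, h₀'' x, h₁' x, h₁'' x, h₂' x, h₂'' x]
  refine ⟨![A₀, A₁'', A₂, A₃', A₄, A₅'], fun f x => ?_⟩
  simp only [formNonneg_interiorForm]
  fin_cases f <;> simp [Fin.sum_univ_six] <;>
    linarith [h₀ x, h₀' x, h₀'' x, h₁ x, h₁' x, h₁'' x, h₂ x, h₂' x, h₂'' x, h₃ x, h₄ x, h₅' x]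

theorem exists_eq_eval_add_sum_truncated {s : Plane → ℝ} (hs : s ∈ splineSpace T 3 5) :
    ∃ p : MvPolynomial (Fin 2) ℝ, p.totalDegree ≤ 5 ∧ ∃ A : Fin 6 → Plane →ᵃ[ℝ] ℝ,
      ∀ x ∈ macroTriangle T, s x = eval (fun k => x k) p +
        ∑ k, A k x * max (affineForm T (castForm (interiorForm k)) x) 0 ^ 4 := by
  obtain ⟨-, hsmooth, hpoly⟩ := hs
  choose p hdeg hp using hpoly
  have hne : ∀ k, ∃ i j, interiorForm k i ≠ interiorForm k j := by decide +kernel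
  obtain ⟨A, hA⟩ := exists_cofactors (T := T) (p := fun f x => eval (fun k => x k) (p f))
    fun hedge => exists_eval_eq_add_mul_pow hsmooth hdeg hp hedge (hne _)
  refine ⟨p 0, hdeg 0, A, fun x hx => ?_⟩
  obtain ⟨f, hf⟩ := exists_mem_face hx
  have hline : ∀ k, interiorForm k ∈ lineForms := by decide +kernel
  rw [hp f x hf, hA f x]
  congr! 2 with k
  rw [max_affineForm_of_mem_face (hline k) hf]
  split_ifs <;> simp

end

/-! ### The dimension of the spline space -/

section

open MvPolynomial

theorem finrank_restrictTotalDegree_five :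
    Module.finrank ℝ (restrictTotalDegree (Fin 2) ℝ 5) = 21 := by
  let e : (Fin 2 →₀ ℕ) ≃ ℕ × ℕ := Finsupp.equivFunOnFinite.trans (finTwoArrowEquiv ℕ)
  let B : Finset (ℕ × ℕ) := (Finset.range 6 ×ˢ Finset.range 6).filter fun m => m.1 + m.2 ≤ 5
  have hcard : {n : Fin 2 →₀ ℕ | (n.sum fun _ e => e) ≤ 5} = e ⁻¹' B := by
    ext n
    have hsum : (n.sum fun _ e => e) = n 0 + n 1 := by simp [Finsupp.sum_fintype]
    change (n.sum fun _ e => e) ≤ 5 ↔ (n 0, n 1) ∈ B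
    rw [hsum, Finset.mem_filter, Finset.mem_product, Finset.mem_range, Finset.mem_range]
    omega
  rw [restrictTotalDegree, Module.finrank_eq_nat_card_basis (basisRestrictSupport ℝ _),
    Nat.card_coe_set_eq, hcard,
    Set.ncard_preimage_of_injective_subset_range e.injective (by simp), Set.ncard_coe_finset]
  rfl

theorem finrank_affineMap_plane : Module.finrank ℝ (Plane →ᵃ[ℝ] ℝ) = 3 := by
  rw [AffineMap.finrank_eq]
  simp

variable (T : AffineBasis (Fin 3) ℝ Plane)

/-- The function on the macrotriangle that is the sum of a polynomial and of truncated fourth powers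
of the equations of the six interior lines with affine coefficients. -/
noncomputable def truncatedSpline :
    (restrictTotalDegree (Fin 2) ℝ 5 × (Fin 6 → Plane →ᵃ[ℝ] ℝ)) →ₗ[ℝ] Plane → ℝ where
  toFun z := (macroTriangle T).indicator fun x => eval (fun k => x k) z.1.1 +
    ∑ k, z.2 k x * max (affineForm T (castForm (interiorForm k)) x) 0 ^ 4
  map_add' z z' := by
    funext x
    by_cases hx : x ∈ macroTriangle T
    · simp only [Pi.add_apply, Set.indicator_of_mem hx, Prod.fst_add, Prod.snd_add,
        Submodule.coe_add, map_add, AffineMap.coe_add, add_mul, Finset.sum_add_distrib]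
      ring
    · simp [hx]
  map_smul' c z := by
    funext x
    by_cases hx : x ∈ macroTriangle T <;>
      simp [hx, smul_eval, Finset.mul_sum, mul_add, mul_assoc]

theorem splineSpace_le_range_truncatedSpline :
    splineSpace T 3 5 ≤ LinearMap.range (truncatedSpline T) := by
  intro s hs
  obtain ⟨p, hp, A, hA⟩ := exists_eq_eval_add_sum_truncated hs
  refine ⟨(⟨p, (mem_restrictTotalDegree _ _ _).2 hp⟩, A), funext fun x => ?_⟩
  simp only [truncatedSpline, LinearMap.coe_mk, AddHom.coe_mk]
  by_cases hx : x ∈ macroTriangle T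
  · rw [Set.indicator_of_mem hx, hA x hx]
  · rw [Set.indicator_of_notMem hx, hs.1 x hx]

instance : Module.Finite ℝ (splineSpace T 3 5) :=
  Submodule.finiteDimensional_of_le (splineSpace_le_range_truncatedSpline T)

theorem finrank_splineSpace_le : Module.finrank ℝ (splineSpace T 3 5) ≤ 39 :=
  calc Module.finrank ℝ (splineSpace T 3 5)
      ≤ Module.finrank ℝ (LinearMap.range (truncatedSpline T)) :=
        Submodule.finrank_mono (splineSpace_le_range_truncatedSpline T)
    _ ≤ Module.finrank ℝ (restrictTotalDegree (Fin 2) ℝ 5 × (Fin 6 → Plane →ᵃ[ℝ] ℝ)) :=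
        LinearMap.finrank_range_le _
    _ = 39 := by
        rw [Module.finrank_prod, Module.finrank_pi_fintype, Finset.sum_const,
          finrank_restrictTotalDegree_five, finrank_affineMap_plane]
        rfl

end

/-! ### The nodal basis -/

theorem exists_eq_formulaIndex : ∀ μ : NodalIndex, ∃ (σ : Equiv.Perm (Fin 3)) (F : Fin 8),
    μ = formulaIndex σ F := by
  decide +kernel

/-- The spline given by formula `F`, relabelled by `σ`. -/
noncomputable def relabelledSpline (T : AffineBasis (Fin 3) ℝ Plane) {cell : Plane → Set Plane}
    (hcell : IsFaceAssignment T cell) (σ : Equiv.Perm (Fin 3)) (F : Fin 8) : splineSpace T 3 5 :=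
  ⟨nodalSpline (T ∘ σ) cell F, nodalSpline_comp_perm_mem_splineSpace T hcell σ F⟩

theorem nodalDual_relabelledSpline (T : AffineBasis (Fin 3) ℝ Plane) {cell : Plane → Set Plane}
    (hcell : IsFaceAssignment T cell) (σ : Equiv.Perm (Fin 3)) (F : Fin 8) (μ : NodalIndex) :
    nodalDual T μ (relabelledSpline T hcell σ F) = if μ = formulaIndex σ F then 1 else 0 :=
  nodalFunctional_nodalSpline T hcell σ F μ

theorem exists_nodalBasis (T : AffineBasis (Fin 3) ℝ Plane) {cell : Plane → Set Plane}
    (hcell : IsFaceAssignment T cell) :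
    ∃ b : Module.Basis NodalIndex ℝ (splineSpace T 3 5),
      (∀ l μ, nodalFunctional T μ (b l) = if μ = l then 1 else 0) ∧
      ∀ σ F, (b (formulaIndex σ F) : Plane → ℝ) = nodalSpline (T ∘ σ) cell F := by
  choose σ F hindex using exists_eq_formulaIndex
  let s : NodalIndex → splineSpace T 3 5 := fun l => relabelledSpline T hcell (σ l) (F l)
  have hdual : ∀ l μ, nodalDual T μ (s l) = if μ = l then 1 else 0 := fun l μ => by
    rw [nodalDual_relabelledSpline, ← hindex]
  have hli : LinearIndependent ℝ s := .of_pairwise_dual_eq_zero_one s (nodalDual T)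
    (fun l μ h => (hdual μ l).trans (if_neg h)) fun l => (hdual l l).trans (if_pos rfl)
  have hcard : Fintype.card NodalIndex = Module.finrank ℝ (splineSpace T 3 5) :=
    le_antisymm hli.fintype_card_le_finrank
      ((finrank_splineSpace_le T).trans card_nodalIndex.ge)
  let b := basisOfLinearIndependentOfCardEqFinrank' s hli hcard
  have hb : ∀ l, b l = s l := fun l => by simp [b]
  have hcoord : ∀ μ, b.coord μ = nodalDual T μ := fun μ => b.ext fun l => by
    rw [hb, hdual, ← hb, b.coord_apply, b.repr_self, Finsupp.single_apply]
    simp only [eq_comm]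
  have hformula : ∀ τ G, b (formulaIndex τ G) = relabelledSpline T hcell τ G := fun τ G =>
    b.ext_elem fun μ => by
      rw [← b.coord_apply, ← b.coord_apply, hcoord, hb, hdual, nodalDual_relabelledSpline]
  exact ⟨b, fun l μ => hb l ▸ hdual l μ, fun τ G => congrArg Subtype.val (hformula τ G)⟩

end PowellSabin

theorem mainTheorem6 (v : Fin 3 → Plane) (hv : AffineIndependent ℝ v)
    (cell : Plane → Set Plane) (hcell : IsFaceAssignment v cell) :
    ∃ b : Module.Basis NodalIndex ℝ (splineSpace v 3 5),
      (∀ l, nodalFunctional v l (b l) = 1) ∧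
      (∀ l l', l ≠ l' → nodalFunctional v l' (b l) = 0) ∧
      ∀ σ : Equiv.Perm (Fin 3),
        let Q := simplexSpline₆ (fun k => v (σ k)) cell
        (b (vertexIndex σ 0 0) : Plane → ℝ) =
          (1 / 4 : ℝ) • Q 6 0 0 1 0 1
          + (1 / 4 : ℝ) • (Q 5 0 0 2 0 1 + Q 5 0 0 1 0 2)
          + (1 / 2 : ℝ) • (Q 4 1 0 2 0 1 + Q 4 0 1 1 0 2)
          + Q 4 1 1 1 0 1
          + (1 / 2 : ℝ) • (Q 3 1 1 2 0 1 + Q 3 1 1 1 0 2)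
          + (1 / 2 : ℝ) • (Q 3 2 0 2 0 1 + Q 3 0 2 1 0 2)
          + (9 / 16 : ℝ) • (Q 2 1 1 2 1 1 + Q 2 1 1 1 1 2)
          + (3 / 8 : ℝ) • (Q 2 2 0 2 1 1 + Q 2 0 2 1 1 2)
          + (3 / 16 : ℝ) • (Q 1 1 2 1 1 2 + Q 1 2 1 2 1 1) ∧
        (b (vertexIndex σ 1 0) : Plane → ℝ) =
          (1 / 40 : ℝ) • Q 5 0 0 2 0 1 + (1 / 10 : ℝ) • Q 4 1 0 2 0 1
          + (1 / 5 : ℝ) • Q 3 2 0 2 0 1 + (1 / 10 : ℝ) • Q 4 1 1 1 0 1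
          + (3 / 20 : ℝ) • Q 3 1 1 2 0 1 + (13 / 80 : ℝ) • Q 2 2 0 2 1 1
          + (1 / 20 : ℝ) • Q 3 1 1 1 0 2 + (19 / 80 : ℝ) • Q 2 1 1 2 1 1
          + (1 / 10 : ℝ) • Q 1 2 1 2 1 1 - (1 / 40 : ℝ) • Q 2 1 1 1 1 2
          - (1 / 40 : ℝ) • Q 2 0 2 1 1 2 - (1 / 20 : ℝ) • Q 1 1 2 1 1 2 ∧
        (b (vertexIndex σ 2 0) : Plane → ℝ) =
          (1 / 160 : ℝ) • Q 4 1 0 2 0 1 + (1 / 32 : ℝ) • Q 3 2 0 2 0 1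
          + (1 / 80 : ℝ) • Q 3 1 1 2 0 1 + (17 / 640 : ℝ) • Q 2 2 0 2 1 1
          + (121 / 3840 : ℝ) • Q 2 1 1 2 1 1 + (71 / 3840 : ℝ) • Q 1 2 1 2 1 1
          - (1 / 48 : ℝ) • Q 2 1 1 1 1 2 + (1 / 480 : ℝ) • Q 1 1 2 1 1 2 ∧
        (b (vertexIndex σ 1 1) : Plane → ℝ) =
          (1 / 80 : ℝ) • Q 4 1 1 1 0 1
          + (3 / 160 : ℝ) • (Q 3 1 1 2 0 1 + Q 3 1 1 1 0 2)
          - (1 / 160 : ℝ) • (Q 2 2 0 2 1 1 + Q 2 0 2 1 1 2)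
          + (17 / 960 : ℝ) • (Q 2 1 1 1 1 2 + Q 2 1 1 2 1 1)
          - (7 / 480 : ℝ) • (Q 1 1 2 1 1 2 + Q 1 2 1 2 1 1) ∧
        (b (vertexIndex σ 3 0) : Plane → ℝ) =
          (1 / 480 : ℝ) • Q 3 2 0 2 0 1 + (7 / 3840 : ℝ) • Q 2 2 0 2 1 1
          + (5 / 3072 : ℝ) • Q 2 1 1 2 1 1 + (7 / 5120 : ℝ) • Q 1 2 1 2 1 1 ∧
        (b (vertexIndex σ 2 1) : Plane → ℝ) =
          (1 / 480 : ℝ) • Q 3 1 1 2 0 1 - (1 / 1920 : ℝ) • Q 2 2 0 2 1 1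
          - (1 / 768 : ℝ) • Q 1 2 1 2 1 1 + (11 / 3840 : ℝ) • Q 2 1 1 2 1 1
          - (11 / 3840 : ℝ) • Q 2 1 1 1 1 2 + (1 / 3840 : ℝ) • Q 1 1 2 1 1 2 ∧
        (b (quarterIndex σ) : Plane → ℝ) =
          (7 / 240 : ℝ) • Q 2 1 1 2 1 1 - (1 / 240 : ℝ) • Q 1 2 1 2 1 1 ∧
        (b (midIndex σ) : Plane → ℝ) =
          (1 / 10 : ℝ) • Q 2 2 0 2 1 1
          + (1 / 5 : ℝ) • (Q 2 1 1 2 1 1 + Q 1 2 1 2 1 1) := by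
  let T : AffineBasis (Fin 3) ℝ Plane :=
    ⟨v, hv, hv.affineSpan_eq_top_iff_card_eq_finrank_add_one.2 (by simp)⟩
  obtain ⟨b, hdual, hformula⟩ := exists_nodalBasis T hcell
  refine ⟨b, fun l => (hdual l l).trans (if_pos rfl),
    fun l l' h => (hdual l l').trans (if_neg h.symm), fun σ => ?_⟩
  intro Q
  have h := hformula σ
  refine ⟨(h 0).trans ?_, (h 1).trans ?_, (h 2).trans ?_, (h 3).trans ?_, (h 4).trans ?_,
    (h 5).trans ?_, (h 6).trans ?_, (h 7).trans ?_⟩ <;>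
  · funext x
    change nodalSpline (fun k => v (σ k)) cell _ x = _
    simp only [nodalSpline, formulaTerms, formulaScale, Matrix.cons_val, List.map_cons,
      List.map_nil, List.sum_cons, List.sum_nil, simplexSpline_knotCount_knots, Pi.add_apply,
      Pi.sub_apply, Pi.smul_apply, smul_eq_mul, Q]
    push_cast
    ring
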